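/- Conventions. Let $\mathcal{A}$ be an abelian category. A nonzero object $H$ is \emph{monoform} if there are no subobjects $0\neq L'\subsetneq L\subseteq H$ and $0\neq N\subseteq H$ with $L/L'\cong N$. Two monoform objects are \emph{atom-equivalent} if they have isomorphic nonzero subobjects; this is an equivalence relation, and its set of classes is the atom spectrum $\operatorname{ASpec}\mathcal{A}$, whose elements are called atoms. For an object $M$, $\operatorname{ASupp}M$ is the set of atoms represented by monoform subquotients of $M$, and $\operatorname{ASpec}\mathcal{A}$ carries the topology with the sets $\operatorname{ASupp}M$ as open basis. For a full subcategory $\mathcal{S}$ put $\operatorname{ASupp}\mathcal{S}=\bigcup_{M\in\mathcal{S}}\operatorname{ASupp}M$, and for $\Phi\subseteq\operatorname{ASpec}\mathcal{A}$ put $\operatorname{ASupp}^{-1}\Phi=\{M\in\mathcal{A}\mid\operatorname{ASupp}M\subseteq\Phi\}$. Fix for every atom a monoform representative. For atoms $\alpha,\beta$ with fixed representatives $H_\alpha,H_\beta$, an object $N$ and an integer $i\geq 0$, define \[ \operatorname{Ext}^i_{\mathcal{A}}(\alpha,N)=\varinjlim_{0\neq L\subseteq H_\alpha}\operatorname{Ext}^i_{\mathcal{A}}(L,N),\qquad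 \operatorname{Ext}^i_{\mathcal{A}}(\alpha,\beta)=\varprojlim_{0\neq L\subseteq H_\beta}\operatorname{Ext}^i_{\mathcal{A}}(\alpha,L), \] where the limits run over the nonzero subobjects $L$. Composition of partially defined morphisms makes $k(\alpha)=\varinjlim_{0\neq L\subseteq H_\alpha}\operatorname{Hom}_{\mathcal{A}}(L,H_\alpha)$ a skew field and $\operatorname{Ext}^i_{\mathcal{A}}(\alpha,N)$ a right $k(\alpha)$-module. With $D_\alpha=\operatorname{Hom}_{k(\alpha)}(-,k(\alpha))$, the \emph{virtual dual} of $\operatorname{Ext}^i_{\mathcal{A}}(\alpha,\beta)$ is $\varinjlim_{0\neq L\subseteq H_\beta}D_\alpha\operatorname{Ext}^i_{\mathcal{A}}(\alpha,L)$. Let $\operatorname{Const}_i(\alpha)$ be the set of atoms $\beta$ such that $\operatorname{Ext}^i_{\mathcal{A}}(\alpha,\beta)\neq 0$ and, for some nonzero $L\subseteq H_\beta$, the map $\operatorname{Ext}^i_{\mathcal{A}}(\alpha,L_2)\to\operatorname{Ext}^i_{\mathcal{A}}(\alpha,L_1)$ is bijective for all nonzero $L_2\subseteq L_1\subseteq L$.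 A Serre subcategory is a full subcategory containing $0$ and closed under subobjects, quotient objects and extensions; a localizing subcategory of a Grothendieck category is a Serre subcategory closed under direct sums. A Grothendieck category is locally noetherian if it has a generating set of noetherian objects; an abelian category is noetherian if it is skeletally small and all its objects are noetherian. Subcategories and subsets are ordered by inclusion. Theorem. \begin{enumerate} \item Let $\mathcal{G}$ be a locally noetherian Grothendieck category. The assignment $\mathcal{X}\mapsto\operatorname{ASupp}\mathcal{X}$ is an isomorphism of ordered sets from the localizing subcategories of $\mathcal{G}$ to the open subsets of $\operatorname{ASpec}\mathcal{G}$, with inverse $\Phi\mapsto\operatorname{ASupp}^{-1}\Phi$. It restricts to an isomorphism of ordered sets between the localizing subcategories of $\mathcal{G}$ that are closed under injective envelopes and the open subsets $\Phi$ of $\operatorname{ASpec}\mathcal{G}$ such that $\operatorname{Ext}^1_{\mathcal{G}}(\alpha,\beta)=0$ for all $\alpha\in\operatorname{ASpec}\mathcal{G}\setminus\Phi$ and $\beta\in\Phi$. \item Let $\mathcal{A}$ be a noetherian abelian category. The assignment $\mathcal{S}\mapsto\operatorname{ASupp}\mathcal{S}$ is an isomorphism of ordered sets from the Serre subcategories of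 $\mathcal{A}$ to the open subsets of $\operatorname{ASpec}\mathcal{A}$, with inverse $\Phi\mapsto\operatorname{ASupp}^{-1}\Phi$. It restricts to an isomorphism of ordered sets between the Serre subcategories of $\mathcal{A}$ that are closed under essential extensions and the open subsets $\Phi$ of $\operatorname{ASpec}\mathcal{A}$ such that $\operatorname{Ext}^1_{\mathcal{A}}(\alpha,\beta)=0$ for all $\alpha\in\operatorname{ASpec}\mathcal{A}\setminus\Phi$ and $\beta\in\Phi$. \item Let $\mathcal{A}$ be a locally noetherian Grothendieck category or a noetherian abelian category, and let $\Phi\subseteq\operatorname{ASpec}\mathcal{A}$ be open. The following are equivalent: \begin{enumerate} \item $\operatorname{ASupp}^{-1}\Phi$ is closed under essential extensions; \item $\operatorname{Ext}^1_{\mathcal{A}}(\alpha,N)=0$ for all $\alpha\in\operatorname{ASpec}\mathcal{A}\setminus\Phi$ and $N\in\operatorname{ASupp}^{-1}\Phi$; \item the virtual dual of $\operatorname{Ext}^1_{\mathcal{A}}(\alpha,\beta)$ is zero for all $\alpha\in\operatorname{ASpec}\mathcal{A}\setminus\Phi$ and $\beta\in\Phi$; \item $\operatorname{Ext}^1_{\mathcal{A}}(\alpha,\beta)=0$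 for all $\alpha\in\operatorname{ASpec}\mathcal{A}\setminus\Phi$ and $\beta\in\Phi$; \item $\operatorname{Const}_1(\alpha)\cap\Phi=\emptyset$ for all $\alpha\in\operatorname{ASpec}\mathcal{A}\setminus\Phi$. \end{enumerate} \end{enumerate} -/

import Mathlib

open CategoryTheory CategoryTheory.Limits Opposite

universe w t v u

noncomputable section

namespace AtomExt

variable {A : Type u} [Category.{v} A] [Abelian A]

/-! ### Monoform objects and the atom spectrum -/

/-- A nonzero object `H` is monoform if it has no subobjects `0 ≠ L' ⊊ L ⊆ H` and `0 ≠ N ⊆ H`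
with `L / L' ≅ N`. -/
structure IsMonoform (H : A) : Prop where
  not_isZero : ¬ IsZero H
  not_iso : ∀ (L' L N : Subobject H) (h : L' ≤ L), L' ≠ ⊥ → L' ≠ L → N ≠ ⊥ →
    IsEmpty (cokernel (Subobject.ofLE L' L h) ≅ (N : A))

lemma mk_ne_bot {H X : A} (i : X ⟶ H) [Mono i] (hX : ¬ IsZero X) : Subobject.mk i ≠ ⊥ := by
  intro h
  rw [Subobject.mk_eq_bot_iff_zero] at h
  exact hX (IsZero.of_mono_eq_zero i h)

lemma not_isZero_of_ne_bot {H : A} {L : Subobject H} (hL : L ≠ ⊥) : ¬ IsZero (L : A) := by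
  intro h
  apply hL
  rw [← Subobject.mk_arrow L, Subobject.mk_eq_bot_iff_zero]
  exact h.eq_of_src _ _

/-- A nonzero morphism from a subobject of a monoform object `H` to `H` is mono. -/
lemma IsMonoform.mono_of_ne_zero {H : A} (hH : IsMonoform H) {X : A} (i : X ⟶ H) [Mono i]
    (f : X ⟶ H) (hf : f ≠ 0) : Mono f := by
  by_contra hmono
  have hk : ¬ IsZero (kernel f) := fun h => hmono
    (Preadditive.mono_of_kernel_zero (h.eq_of_src _ _))
  have hle : Subobject.mk (kernel.ι f ≫ i) ≤ Subobject.mk i :=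
    Subobject.mk_le_mk_of_comm (kernel.ι f) rfl
  have him : ¬ IsZero (image f) := fun h => hf (by
    rw [← image.fac f, h.eq_of_src (image.ι f) 0, comp_zero])
  refine (hH.not_iso (Subobject.mk (kernel.ι f ≫ i)) (Subobject.mk i)
    (Subobject.mk (image.ι f)) hle (mk_ne_bot _ hk) ?_ (mk_ne_bot _ him)).false ?_
  · intro h
    apply hf
    have hepi : Epi (kernel.ι f) := by
      have h2 : kernel.ι f = (Subobject.isoOfMkEqMk _ _ h).hom := by
        rw [← cancel_mono i]
        simp [Subobject.isoOfMkEqMk]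
      rw [h2]
      infer_instance
    rw [← cancel_epi (kernel.ι f)]
    simp
  · refine cokernel.mapIso _ (kernel.ι f) (Subobject.underlyingIso _)
      (Subobject.underlyingIso _) ?_ ≪≫ Abelian.coimageIsoImage' f ≪≫
      (Subobject.underlyingIso _).symm
    rw [← cancel_mono i]
    simp

/-- Monoform objects are uniform. -/
lemma IsMonoform.inf_ne_bot {H : A} (hH : IsMonoform H) {L₁ L₂ : Subobject H}
    (h₁ : L₁ ≠ ⊥) (h₂ : L₂ ≠ ⊥) : L₁ ⊓ L₂ ≠ ⊥ := by
  intro h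
  have hmono : Mono (biprod.desc L₁.arrow L₂.arrow) := by
    apply Preadditive.mono_of_cancel_zero
    intro Z g hg
    have h0 : (g ≫ biprod.fst) ≫ L₁.arrow + (g ≫ biprod.snd) ≫ L₂.arrow = 0 := by
      rw [← hg, biprod.desc_eq]
      simp
    have hfac : (L₁ ⊓ L₂).Factors ((g ≫ biprod.fst) ≫ L₁.arrow) := by
      rw [Subobject.inf_factors]
      refine ⟨Subobject.factors_comp_arrow _, ?_⟩
      rw [eq_neg_of_add_eq_zero_left h0, ← Preadditive.neg_comp]
      exact Subobject.factors_comp_arrow _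
    rw [h, Subobject.bot_factors_iff_zero] at hfac
    rw [hfac, zero_add] at h0
    apply biprod.hom_ext
    · rw [zero_comp, ← cancel_mono L₁.arrow, hfac, zero_comp]
    · rw [zero_comp, ← cancel_mono L₂.arrow, h0, zero_comp]
  have hne : (biprod.snd : (L₁ : A) ⊞ (L₂ : A) ⟶ _) ≫ L₂.arrow ≠ 0 := by
    intro h0
    have h3 : biprod.inr ≫ (biprod.snd : (L₁ : A) ⊞ (L₂ : A) ⟶ _) ≫ L₂.arrow = 0 := by
      rw [h0, comp_zero]
    rw [biprod.inr_snd_assoc] at h3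
    exact not_isZero_of_ne_bot h₂ (IsZero.of_mono_eq_zero _ h3)
  have hm2 := hH.mono_of_ne_zero (biprod.desc L₁.arrow L₂.arrow) _ hne
  have h4 : (biprod.inl : (L₁ : A) ⟶ (L₁ : A) ⊞ (L₂ : A)) = 0 := by
    rw [← cancel_mono (biprod.snd ≫ L₂.arrow)]
    simp
  exact not_isZero_of_ne_bot h₁ (IsZero.of_mono_eq_zero _ h4)

variable (A) in
/-- The monoform objects of `A`. -/
structure MonoformObject where
  obj : A
  isMonoform : IsMonoform obj

/-- Two monoform objects are atom-equivalent if they have isomorphic nonzero subobjects. -/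
def AtomEquiv (H₁ H₂ : MonoformObject A) : Prop :=
  ∃ (L₁ : Subobject H₁.obj) (L₂ : Subobject H₂.obj), L₁ ≠ ⊥ ∧ L₂ ≠ ⊥ ∧
    Nonempty ((L₁ : A) ≅ (L₂ : A))

lemma top_ne_bot {H : A} (hH : ¬ IsZero H) : (⊤ : Subobject H) ≠ ⊥ := mk_ne_bot (𝟙 H) hH

instance atomSetoid : Setoid (MonoformObject A) where
  r := AtomEquiv
  iseqv := by
    refine ⟨fun H => ⟨⊤, ⊤, top_ne_bot H.isMonoform.not_isZero,
      top_ne_bot H.isMonoform.not_isZero, ⟨Iso.refl _⟩⟩, ?_, ?_⟩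
    · rintro H₁ H₂ ⟨L₁, L₂, h₁, h₂, ⟨e⟩⟩
      exact ⟨L₂, L₁, h₂, h₁, ⟨e.symm⟩⟩
    · rintro H₁ H₂ H₃ ⟨L₁, L₂, h₁, h₂, ⟨e⟩⟩ ⟨M₂, M₃, k₂, k₃, ⟨e'⟩⟩
      have hK := not_isZero_of_ne_bot (H₂.isMonoform.inf_ne_bot h₂ k₂)
      exact ⟨Subobject.mk (Subobject.ofLE (L₂ ⊓ M₂) L₂ inf_le_left ≫ e.inv ≫ L₁.arrow),
        Subobject.mk (Subobject.ofLE (L₂ ⊓ M₂) M₂ inf_le_right ≫ e'.hom ≫ M₃.arrow),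
        mk_ne_bot _ hK, mk_ne_bot _ hK,
        ⟨Subobject.underlyingIso _ ≪≫ (Subobject.underlyingIso _).symm⟩⟩

variable (A) in
/-- The atom spectrum: monoform objects up to atom-equivalence. -/
def ASpec : Type u := Quotient (atomSetoid (A := A))

/-- The fixed (chosen) monoform representative of an atom. -/
def ASpec.rep (α : ASpec A) : MonoformObject A := Quotient.out α

/-- `X` is a subquotient of `M`: a quotient of a subobject of `M`. -/
def IsSubquotient (X M : A) : Prop :=
  ∃ (L : A) (i : L ⟶ M) (p : L ⟶ X), Mono i ∧ Epi p

/-- The atom support of an object. -/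
def ASupp (M : A) : Set (ASpec A) :=
  {α | ∃ H : MonoformObject A, (Quotient.mk _ H : ASpec A) = α ∧ IsSubquotient H.obj M}

/-- The localizing topology, generated by the atom supports of objects. -/
instance : TopologicalSpace (ASpec A) :=
  TopologicalSpace.generateFrom (Set.range (ASupp (A := A)))

/-- The union of the atom supports of the objects of a subcategory. -/
def ASuppOf (S : ObjectProperty A) : Set (ASpec A) := ⋃ (M : A) (_ : S M), ASupp M

/-- The objects whose atom support is contained in `Φ`. -/
def ASuppInv (Φ : Set (ASpec A)) : ObjectProperty A := fun M => ASupp M ⊆ Φ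

/-! ### Subcategories -/

/-- A monomorphism is essential if its image meets every nonzero subobject nontrivially. -/
def IsEssentialMono {M E : A} (i : M ⟶ E) [Mono i] : Prop :=
  ∀ L : Subobject E, L ≠ ⊥ → Subobject.mk i ⊓ L ≠ ⊥

/-- Closure under essential extensions. -/
def ClosedUnderEssentialExtensions (S : ObjectProperty A) : Prop :=
  ∀ ⦃M E : A⦄ (i : M ⟶ E) [Mono i], IsEssentialMono i → S M → S E

/-- Closure under injective envelopes; an injective envelope of `M` is an essential
monomorphism from `M` to an injective object. -/
def ClosedUnderInjectiveEnvelopes (S : ObjectProperty A) : Prop :=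
  ∀ ⦃M E : A⦄ (i : M ⟶ E) [Mono i], Injective E → IsEssentialMono i → S M → S E

variable (A) in
/-- Serre subcategories, ordered by inclusion. -/
abbrev SerreSubcategory := {S : ObjectProperty A // S.IsSerreClass}

variable (A) in
/-- Localizing subcategories: Serre subcategories closed under all small direct sums. -/
abbrev LocalizingSubcategory :=
  {S : ObjectProperty A // S.IsSerreClass ∧
    ∀ J : Type w, S.IsClosedUnderColimitsOfShape (Discrete J)}

variable (A) in
/-- `A` has a small generating family of noetherian objects. A Grothendieck category with this
property is called locally noetherian. -/
def HasNoetherianGenerators : Prop :=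
  ∃ (ι : Type w) (U : ι → A), (∀ i, IsNoetherianObject (U i)) ∧
    ∀ ⦃X Y : A⦄ (f : X ⟶ Y), f ≠ 0 → ∃ (i : ι) (g : U i ⟶ X), g ≫ f ≠ 0

/-! ### Values of contravariant functors at a monoform object viewed as a pro-object -/

/-- The nonzero subobjects of an object. -/
abbrev NonzeroSub (H : A) := {L : Subobject H // L ≠ ⊥}

/-- The values of `F` on the nonzero subobjects of `H`, ordered by reverse inclusion. -/
abbrev sysObj (H : A) (F : Aᵒᵖ ⥤ AddCommGrpCat.{t}) (L : (NonzeroSub H)ᵒᵈ) : Type t :=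
  F.obj (op (L.ofDual.1 : A))

/-- The restriction maps between the values of `F` on nonzero subobjects of `H`. -/
abbrev sysMap (H : A) (F : Aᵒᵖ ⥤ AddCommGrpCat.{t}) (L M : (NonzeroSub H)ᵒᵈ) (h : L ≤ M) :
    sysObj H F L →+ sysObj H F M :=
  (F.map (Subobject.ofLE M.ofDual.1 L.ofDual.1 h).op).hom

open scoped Classical in
/-- The direct limit of `F L` over the nonzero subobjects `L` of `H`, directed by reverse
inclusion. -/
def Stalk (H : MonoformObject A) (F : Aᵒᵖ ⥤ AddCommGrpCat.{t}) : Type (max t v u) :=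
  AddCommGroup.DirectLimit (sysObj H.obj F) (sysMap H.obj F)

namespace Stalk

variable {H : MonoformObject A} {F F' : Aᵒᵖ ⥤ AddCommGrpCat.{t}}

open scoped Classical in
instance : AddCommGroup (Stalk H F) :=
  AddCommGroup.DirectLimit.addCommGroup (sysObj H.obj F) (sysMap H.obj F)

open scoped Classical in
/-- The canonical map to the direct limit. -/
def of (L : NonzeroSub H.obj) : F.obj (op (L.1 : A)) →+ Stalk H F :=
  AddCommGroup.DirectLimit.of (sysObj H.obj F) (sysMap H.obj F) (OrderDual.toDual L)

lemma of_map {L M : NonzeroSub H.obj} (h : M.1 ≤ L.1) (x : F.obj (op (L.1 : A))) :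
    of M ((F.map (Subobject.ofLE _ _ h).op).hom x) = of L x := by
  classical
  exact AddCommGroup.DirectLimit.of_f (G := sysObj H.obj F) (f := sysMap H.obj F)
    (i := OrderDual.toDual L) (j := OrderDual.toDual M) h x

open scoped Classical in
/-- The universal property of the direct limit. -/
def lift {P : Type*} [AddCommGroup P] (g : ∀ L : NonzeroSub H.obj, F.obj (op (L.1 : A)) →+ P)
    (hg : ∀ (L M : NonzeroSub H.obj) (h : M.1 ≤ L.1) (x : F.obj (op (L.1 : A))),
      g M ((F.map (Subobject.ofLE _ _ h).op).hom x) = g L x) : Stalk H F →+ P :=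
  AddCommGroup.DirectLimit.lift (sysObj H.obj F) (sysMap H.obj F) P
    (fun L => g L.ofDual) (fun L M h x => hg L.ofDual M.ofDual h x)

@[simp]
lemma lift_of {P : Type*} [AddCommGroup P]
    (g : ∀ L : NonzeroSub H.obj, F.obj (op (L.1 : A)) →+ P) (hg) (L : NonzeroSub H.obj)
    (x : F.obj (op (L.1 : A))) : lift g hg (of L x) = g L x := by
  classical
  exact AddCommGroup.DirectLimit.lift_of (G := sysObj H.obj F) (f := sysMap H.obj F) P
    (fun L => g L.ofDual) (fun L M h x => hg L.ofDual M.ofDual h x) (OrderDual.toDual L) x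

lemma hom_ext {P : Type*} [AddCommGroup P] {g₁ g₂ : Stalk H F →+ P}
    (h : ∀ (L : NonzeroSub H.obj) (x : F.obj (op (L.1 : A))), g₁ (of L x) = g₂ (of L x)) :
    g₁ = g₂ := by
  classical
  exact AddCommGroup.DirectLimit.hom_ext (G := sysObj H.obj F) (f := sysMap H.obj F) P
    (fun L => AddMonoidHom.ext fun x => h L.ofDual x)

/-- Functoriality in `F`. -/
def map (φ : F ⟶ F') : Stalk H F →+ Stalk H F' :=
  lift (fun L => (of L).comp (φ.app (op (L.1 : A))).hom) (fun L M h x => by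
    have := ConcreteCategory.congr_hom (φ.naturality (Subobject.ofLE _ _ h).op) x
    simp only [AddMonoidHom.coe_comp, Function.comp_apply]
    rw [← of_map h]
    exact congrArg _ this)

@[simp]
lemma map_of (φ : F ⟶ F') (L : NonzeroSub H.obj) (x : F.obj (op (L.1 : A))) :
    map φ (of L x) = of L ((φ.app (op (L.1 : A))).hom x) := by
  simp [map]

/-- The canonical map to the direct limit from the value at the source of a monomorphism
to `H`. -/
def ofMono {X : A} (j : X ⟶ H.obj) [Mono j] (hX : ¬ IsZero X) : F.obj (op X) →+ Stalk H F :=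
  (of ⟨Subobject.mk j, mk_ne_bot j hX⟩).comp (F.map (Subobject.underlyingIso j).hom.op).hom

lemma ofMono_comp {X X' : A} (j : X ⟶ H.obj) [Mono j] (hX : ¬ IsZero X)
    (j' : X' ⟶ H.obj) [Mono j'] (hX' : ¬ IsZero X') (g : X' ⟶ X) (hg : g ≫ j = j')
    (x : F.obj (op X)) : ofMono j' hX' ((F.map g.op).hom x) = ofMono j hX x := by
  have hle : Subobject.mk j' ≤ Subobject.mk j := Subobject.mk_le_mk_of_comm g hg
  simp only [ofMono, AddMonoidHom.coe_comp, Function.comp_apply]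
  rw [← of_map (L := ⟨Subobject.mk j, mk_ne_bot j hX⟩)
    (M := ⟨Subobject.mk j', mk_ne_bot j' hX'⟩) hle]
  congr 1
  have e : (Subobject.underlyingIso j').hom ≫ g =
      Subobject.ofLE _ _ hle ≫ (Subobject.underlyingIso j).hom := by
    rw [← cancel_mono j]
    simp [hg]
  have e2 : F.map g.op ≫ F.map (Subobject.underlyingIso j').hom.op =
      F.map (Subobject.underlyingIso j).hom.op ≫ F.map (Subobject.ofLE _ _ hle).op := by
    rw [← F.map_comp, ← F.map_comp, ← op_comp, ← op_comp, e]
  exact ConcreteCategory.congr_hom e2 x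

lemma ofMono_arrow (L : NonzeroSub H.obj) (x : F.obj (op (L.1 : A))) :
    ofMono L.1.arrow (not_isZero_of_ne_bot L.2) x = of L x := by
  have hle : L.1 ≤ Subobject.mk L.1.arrow := by rw [Subobject.mk_arrow]
  simp only [ofMono, AddMonoidHom.coe_comp, Function.comp_apply]
  rw [← of_map (M := L)
    (L := ⟨Subobject.mk L.1.arrow, mk_ne_bot _ (not_isZero_of_ne_bot L.2)⟩) hle]
  congr 1
  have e : Subobject.ofLE _ _ hle ≫ (Subobject.underlyingIso L.1.arrow).hom = 𝟙 _ := by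
    rw [← cancel_mono L.1.arrow]
    simp
  have e2 : F.map (Subobject.underlyingIso L.1.arrow).hom.op ≫
      F.map (Subobject.ofLE _ _ hle).op = 𝟙 _ := by
    rw [← F.map_comp, ← op_comp, e, op_id, F.map_id]
  exact ConcreteCategory.congr_hom e2 x

/-- The inverse image of a nonzero subobject `M ⊆ H` under a morphism from a nonzero subobject
`L ⊆ H` to `H` is nonzero. -/
lemma not_isZero_pullback (L M : NonzeroSub H.obj) (f : (L.1 : A) ⟶ H.obj) :
    ¬ IsZero (pullback f M.1.arrow) := by
  intro hZ
  by_cases hf : f = 0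
  · apply not_isZero_of_ne_bot L.2
    rw [IsZero.iff_id_eq_zero, ← pullback.lift_fst (f := f) (g := M.1.arrow) (𝟙 (L.1 : A)) 0
      (by simp [hf]), hZ.eq_of_src (pullback.fst f M.1.arrow) 0, comp_zero]
  · have hm := H.isMonoform.mono_of_ne_zero L.1.arrow f hf
    have hK : Subobject.mk f ⊓ M.1 ≠ ⊥ :=
      H.isMonoform.inf_ne_bot (mk_ne_bot f (not_isZero_of_ne_bot L.2)) M.2
    apply not_isZero_of_ne_bot hK
    apply IsZero.of_mono_eq_zero (Subobject.ofLE (Subobject.mk f ⊓ M.1) M.1 inf_le_right)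
    rw [← pullback.lift_snd (f := f) (g := M.1.arrow)
      (Subobject.ofLE (Subobject.mk f ⊓ M.1) (Subobject.mk f) inf_le_left ≫
        (Subobject.underlyingIso f).hom)
      (Subobject.ofLE (Subobject.mk f ⊓ M.1) M.1 inf_le_right) (by simp),
      hZ.eq_of_src (pullback.snd f M.1.arrow) 0, comp_zero]

/-- Pullback of elements of `F M` along `f : L ⟶ H`, as elements of the direct limit:
restrict along `f ⁻¹ M ⟶ M`. -/
def pull (L : NonzeroSub H.obj) (f : (L.1 : A) ⟶ H.obj) (M : NonzeroSub H.obj) :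
    F.obj (op (M.1 : A)) →+ Stalk H F :=
  (ofMono (pullback.fst f M.1.arrow ≫ L.1.arrow) (not_isZero_pullback L M f)).comp
    (F.map (pullback.snd f M.1.arrow).op).hom

lemma pull_eq (L : NonzeroSub H.obj) (f : (L.1 : A) ⟶ H.obj) (M : NonzeroSub H.obj)
    {Z : A} (hZ : ¬ IsZero Z) (z : Z ⟶ H.obj) [Mono z] (l : Z ⟶ (L.1 : A))
    (hl : l ≫ L.1.arrow = z) (m : Z ⟶ (M.1 : A)) (h : l ≫ f = m ≫ M.1.arrow)
    (y : F.obj (op (M.1 : A))) : pull L f M y = ofMono z hZ ((F.map m.op).hom y) := by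
  have e := ofMono_comp (F := F) (pullback.fst f M.1.arrow ≫ L.1.arrow)
    (not_isZero_pullback L M f) z hZ (pullback.lift l m h) (by rw [pullback.lift_fst_assoc, hl])
    ((F.map (pullback.snd f M.1.arrow).op).hom y)
  refine e.symm.trans (congrArg _ ?_)
  have e2 : F.map (pullback.snd f M.1.arrow).op ≫ F.map (pullback.lift l m h).op =
      F.map m.op := by
    rw [← F.map_comp, ← op_comp, pullback.lift_snd]
  exact ConcreteCategory.congr_hom e2 y

/-- The endomorphism of the direct limit induced by `f : L ⟶ H`. -/
def pullEnd (F : Aᵒᵖ ⥤ AddCommGrpCat.{t}) (L : NonzeroSub H.obj) (f : (L.1 : A) ⟶ H.obj) :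
    Stalk H F →+ Stalk H F :=
  lift (fun M => pull L f M) (fun M M' h x => by
    have e : F.map (Subobject.ofLE _ _ h).op ≫ F.map (pullback.snd f M'.1.arrow).op =
        F.map (pullback.snd f M'.1.arrow ≫ Subobject.ofLE _ _ h).op := by
      rw [← F.map_comp, ← op_comp]
    rw [pull_eq L f M (not_isZero_pullback L M' f) _ (pullback.fst f M'.1.arrow) rfl
      (pullback.snd f M'.1.arrow ≫ Subobject.ofLE _ _ h) (by simp [pullback.condition])]
    exact congrArg (ofMono _ (not_isZero_pullback L M' f)) (ConcreteCategory.congr_hom e x))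

lemma pullEnd_of (L : NonzeroSub H.obj) (f : (L.1 : A) ⟶ H.obj) (M : NonzeroSub H.obj)
    {Z : A} (hZ : ¬ IsZero Z) (z : Z ⟶ H.obj) [Mono z] (l : Z ⟶ (L.1 : A))
    (hl : l ≫ L.1.arrow = z) (m : Z ⟶ (M.1 : A)) (h : l ≫ f = m ≫ M.1.arrow)
    (y : F.obj (op (M.1 : A))) :
    pullEnd F L f (of M y) = ofMono z hZ ((F.map m.op).hom y) := by
  rw [pullEnd, lift_of, pull_eq L f M hZ z l hl m h]

lemma exists_of (x : Stalk H F) : ∃ (L : NonzeroSub H.obj) (y : F.obj (op (L.1 : A))),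
    of L y = x := by
  classical
  have : Nonempty (NonzeroSub H.obj)ᵒᵈ := ⟨OrderDual.toDual ⟨⊤,
    top_ne_bot H.isMonoform.not_isZero⟩⟩
  have : IsDirectedOrder (NonzeroSub H.obj)ᵒᵈ := ⟨fun L M =>
    ⟨OrderDual.toDual ⟨L.ofDual.1 ⊓ M.ofDual.1,
      H.isMonoform.inf_ne_bot L.ofDual.2 M.ofDual.2⟩,
      (inf_le_left : L.ofDual.1 ⊓ M.ofDual.1 ≤ L.ofDual.1),
      (inf_le_right : L.ofDual.1 ⊓ M.ofDual.1 ≤ M.ofDual.1)⟩⟩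
  exact AddCommGroup.DirectLimit.induction_on (G := sysObj H.obj F) (f := sysMap H.obj F)
    (C := fun x => ∃ (L : NonzeroSub H.obj) (y : F.obj (op (L.1 : A))), of L y = x) x
    (fun L y => ⟨L.ofDual, y, rfl⟩)

lemma map_ofMono (φ : F ⟶ F') {X : A} (j : X ⟶ H.obj) [Mono j] (hX : ¬ IsZero X)
    (x : F.obj (op X)) : map φ (ofMono j hX x) = ofMono j hX ((φ.app (op X)).hom x) := by
  simp only [ofMono, AddMonoidHom.coe_comp, Function.comp_apply]
  refine (map_of φ ⟨Subobject.mk j, mk_ne_bot j hX⟩ _).trans ?_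
  exact congrArg (of ⟨Subobject.mk j, mk_ne_bot j hX⟩)
    (ConcreteCategory.congr_hom (φ.naturality (Subobject.underlyingIso j).hom.op) x)

lemma pullEnd_of_eq_pull (L : NonzeroSub H.obj) (f : (L.1 : A) ⟶ H.obj) (M : NonzeroSub H.obj)
    (y : F.obj (op (M.1 : A))) : pullEnd F L f (of M y) = pull L f M y := by
  rw [pullEnd, lift_of]

lemma map_pullEnd (φ : F ⟶ F') (L : NonzeroSub H.obj) (f : (L.1 : A) ⟶ H.obj)
    (x : Stalk H F) : map φ (pullEnd F L f x) = pullEnd F' L f (map φ x) := by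
  obtain ⟨M, y, rfl⟩ := exists_of x
  rw [map_of, pullEnd_of_eq_pull, pullEnd_of_eq_pull]
  simp only [pull, AddMonoidHom.coe_comp, Function.comp_apply, map_ofMono]
  exact congrArg _
    (ConcreteCategory.congr_hom (φ.naturality (pullback.snd f M.1.arrow).op) y)

lemma pullEnd_add [F.Additive] (L : NonzeroSub H.obj) (f g : (L.1 : A) ⟶ H.obj) :
    pullEnd F L (f + g) = pullEnd F L f + pullEnd F L g := by
  apply hom_ext
  intro M y
  let P : NonzeroSub H.obj :=
    ⟨Subobject.mk (pullback.fst f M.1.arrow ≫ L.1.arrow),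
      mk_ne_bot _ (not_isZero_pullback L M f)⟩
  let iP : (P.1 : A) ⟶ pullback f M.1.arrow := (Subobject.underlyingIso _).hom
  have hiP : iP ≫ pullback.fst f M.1.arrow ≫ L.1.arrow = P.1.arrow := by simp [iP, P]
  let p : (P.1 : A) ⟶ (L.1 : A) := iP ≫ pullback.fst f M.1.arrow
  let Q : NonzeroSub H.obj :=
    ⟨Subobject.mk (pullback.fst g M.1.arrow ≫ L.1.arrow),
      mk_ne_bot _ (not_isZero_pullback L M g)⟩
  let iQ : (Q.1 : A) ⟶ pullback g M.1.arrow := (Subobject.underlyingIso _).hom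
  have hiQ : iQ ≫ pullback.fst g M.1.arrow ≫ L.1.arrow = Q.1.arrow := by simp [iQ, Q]
  have hZ := not_isZero_of_ne_bot (H.isMonoform.inf_ne_bot P.2 Q.2)
  let a := Subobject.ofLE (P.1 ⊓ Q.1) P.1 inf_le_left
  let b := Subobject.ofLE (P.1 ⊓ Q.1) Q.1 inf_le_right
  have hl : (a ≫ p) ≫ L.1.arrow = (P.1 ⊓ Q.1).arrow := by
    simp only [p, a, Category.assoc, hiP, Subobject.ofLE_arrow]
  have hl' : (b ≫ iQ ≫ pullback.fst g M.1.arrow) = a ≫ p := by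
    rw [← cancel_mono L.1.arrow, hl]
    simp only [b, Category.assoc, hiQ, Subobject.ofLE_arrow]
  have hf : (a ≫ p) ≫ f = (a ≫ iP ≫ pullback.snd f M.1.arrow) ≫ M.1.arrow := by
    simp [p, pullback.condition]
  have hg : (a ≫ p) ≫ g = (b ≫ iQ ≫ pullback.snd g M.1.arrow) ≫ M.1.arrow := by
    rw [← hl']
    simp [pullback.condition]
  rw [AddMonoidHom.add_apply, pullEnd_of L f M hZ _ _ hl _ hf, pullEnd_of L g M hZ _ _ hl _ hg,
    pullEnd_of L (f + g) M hZ _ _ hl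
      (a ≫ iP ≫ pullback.snd f M.1.arrow + b ≫ iQ ≫ pullback.snd g M.1.arrow)
      (by rw [Preadditive.comp_add, hf, hg, Preadditive.add_comp]), ← map_add, op_add, F.map_add]
  rfl

lemma pullEnd_restrict {L L' : NonzeroSub H.obj} (h : L'.1 ≤ L.1) (f : (L.1 : A) ⟶ H.obj) :
    pullEnd F L' (Subobject.ofLE _ _ h ≫ f) = pullEnd F L f := by
  apply hom_ext
  intro M y
  rw [pullEnd_of_eq_pull (f := Subobject.ofLE _ _ h ≫ f),
    pullEnd_of L f M (not_isZero_pullback L' M (Subobject.ofLE _ _ h ≫ f))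
      (pullback.fst (Subobject.ofLE _ _ h ≫ f) M.1.arrow ≫ L'.1.arrow)
      (pullback.fst (Subobject.ofLE _ _ h ≫ f) M.1.arrow ≫ Subobject.ofLE _ _ h)
      (by simp) (pullback.snd _ _) (by simpa using pullback.condition)]
  rfl

end Stalk

/-! ### The residue field and its action -/

/-- The residue field of the atom of `H`: the direct limit of `Hom(L, H)` over the nonzero
subobjects `L ⊆ H`. -/
def ResidueField (H : MonoformObject A) : Type (max v u) :=
  Stalk H (preadditiveYoneda.obj H.obj)

namespace ResidueField

variable {H : MonoformObject A}

instance : AddCommGroup (ResidueField H) :=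
  inferInstanceAs (AddCommGroup (Stalk H (preadditiveYoneda.obj H.obj)))

/-- The class of a morphism `L ⟶ H` from a nonzero subobject. -/
def of (L : NonzeroSub H.obj) (f : (L.1 : A) ⟶ H.obj) : ResidueField H :=
  Stalk.of (F := preadditiveYoneda.obj H.obj) L f

lemma exists_of (x : ResidueField H) : ∃ (L : NonzeroSub H.obj) (f : (L.1 : A) ⟶ H.obj),
    of L f = x :=
  Stalk.exists_of (F := preadditiveYoneda.obj H.obj) x

/-- The right action of the residue field on direct limits: the class of `f : L ⟶ H` sends the
class of `y ∈ F M` to the class of its restriction along `f ⁻¹ M ⟶ M`. -/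
def act (F : Aᵒᵖ ⥤ AddCommGrpCat.{t}) [F.Additive] :
    ResidueField H →+ (Stalk H F →+ Stalk H F) :=
  Stalk.lift (F := preadditiveYoneda.obj H.obj)
    (fun L => AddMonoidHom.mk' (fun f : (L.1 : A) ⟶ H.obj => Stalk.pullEnd F L f)
      (fun f g => Stalk.pullEnd_add L f g))
    (fun _ _ h f => Stalk.pullEnd_restrict h f)

variable (F : Aᵒᵖ ⥤ AddCommGrpCat.{t}) [F.Additive]

lemma act_of (L : NonzeroSub H.obj) (f : (L.1 : A) ⟶ H.obj) :
    act F (of L f) = Stalk.pullEnd F L f :=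
  Stalk.lift_of (F := preadditiveYoneda.obj H.obj) _ _ L f

instance : Mul (ResidueField H) := ⟨fun x y => act (preadditiveYoneda.obj H.obj) y x⟩

instance : One (ResidueField H) :=
  ⟨of ⟨⊤, top_ne_bot H.isMonoform.not_isZero⟩ (⊤ : Subobject H.obj).arrow⟩

lemma one_act (x : Stalk H F) : act F 1 x = x := by
  obtain ⟨M, y, rfl⟩ := Stalk.exists_of x
  refine (congrArg (fun e => e (Stalk.of M y)) (act_of F _ _)).trans ?_
  rw [Stalk.pullEnd_of _ _ M (not_isZero_of_ne_bot M.2) M.1.arrow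
    (Subobject.ofLE M.1 ⊤ le_top) (by simp) (𝟙 _) (by simp)]
  rw [Stalk.ofMono_arrow, op_id, F.map_id]
  rfl

lemma mul_act (x y : ResidueField H) (ξ : Stalk H F) :
    act F (x * y) ξ = act F y (act F x ξ) := by
  obtain ⟨L, f, rfl⟩ := exists_of x
  obtain ⟨L', g, rfl⟩ := exists_of y
  obtain ⟨M, m, rfl⟩ := Stalk.exists_of ξ
  let P : NonzeroSub H.obj :=
    ⟨Subobject.mk (pullback.fst f M.1.arrow ≫ L.1.arrow),
      mk_ne_bot _ (Stalk.not_isZero_pullback L M f)⟩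
  let iP : (P.1 : A) ⟶ pullback f M.1.arrow := (Subobject.underlyingIso _).hom
  have hiP : (iP ≫ pullback.fst f M.1.arrow) ≫ L.1.arrow = P.1.arrow := by simp [iP, P]
  have hf : (iP ≫ pullback.fst f M.1.arrow) ≫ f =
      (iP ≫ pullback.snd f M.1.arrow) ≫ M.1.arrow := by
    simp [pullback.condition]
  let Z := pullback g P.1.arrow
  have hZ : ¬ IsZero Z := Stalk.not_isZero_pullback L' P g
  let z : Z ⟶ H.obj := pullback.fst g P.1.arrow ≫ L'.1.arrow
  let q : Z ⟶ (P.1 : A) := pullback.snd g P.1.arrow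
  have hg : pullback.fst g P.1.arrow ≫ g = q ≫ P.1.arrow := pullback.condition
  let K : NonzeroSub H.obj := ⟨Subobject.mk z, mk_ne_bot z hZ⟩
  have hfg : of L f * of L' g = of K ((Subobject.underlyingIso z).hom ≫
      (q ≫ iP ≫ pullback.fst f M.1.arrow) ≫ f) := by
    refine (congrArg (fun e => e (of L f)) (act_of (preadditiveYoneda.obj H.obj) L' g)).trans ?_
    exact Stalk.pullEnd_of (F := preadditiveYoneda.obj H.obj) L' g L hZ z
      (pullback.fst g P.1.arrow) rfl (q ≫ iP ≫ pullback.fst f M.1.arrow)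
      (by simp only [Category.assoc] at hiP ⊢; rw [hiP, hg]) f
  rw [hfg, act_of, act_of, act_of]
  rw [Stalk.pullEnd_of K _ M hZ z (Subobject.underlyingIso z).inv (by simp [K])
    (q ≫ iP ≫ pullback.snd f M.1.arrow)
    (by rw [Iso.inv_hom_id_assoc]; simpa using congrArg (q ≫ ·) hf),
    Stalk.pullEnd_of L f M (not_isZero_of_ne_bot P.2) P.1.arrow _ hiP _ hf,
    Stalk.ofMono_arrow, Stalk.pullEnd_of L' g P hZ z _ rfl q hg]
  congr 1
  have e : F.map (q ≫ iP ≫ pullback.snd f M.1.arrow).op =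
      F.map (iP ≫ pullback.snd f M.1.arrow).op ≫ F.map q.op := by
    rw [← F.map_comp, ← op_comp]
  exact ConcreteCategory.congr_hom e m

lemma one_mul_aux (x : ResidueField H) : 1 * x = x := by
  obtain ⟨L, f, rfl⟩ := exists_of x
  refine (congrArg (fun e => e (1 : ResidueField H))
    (act_of (preadditiveYoneda.obj H.obj) L f)).trans ?_
  refine (Stalk.pullEnd_of (F := preadditiveYoneda.obj H.obj) L f
    ⟨⊤, top_ne_bot H.isMonoform.not_isZero⟩
    (not_isZero_of_ne_bot L.2) L.1.arrow (𝟙 _) (by simp)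
    (f ≫ inv (⊤ : Subobject H.obj).arrow) (by simp) _).trans ?_
  refine (Stalk.ofMono_arrow (F := preadditiveYoneda.obj H.obj) L _).trans ?_
  refine congrArg (of L) ?_
  exact (Category.assoc _ _ _).trans (by simp)

instance : Ring (ResidueField H) where
  __ := (inferInstance : AddCommGroup (ResidueField H))
  __ := (inferInstance : Mul (ResidueField H))
  __ := (inferInstance : One (ResidueField H))
  left_distrib x y z := by
    change act _ (y + z) x = act _ y x + act _ z x
    rw [map_add]
    rfl
  right_distrib x y z := (act (preadditiveYoneda.obj H.obj) z).map_add x y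
  zero_mul x := (act (preadditiveYoneda.obj H.obj) x).map_zero
  mul_zero x := by
    change act _ 0 x = 0
    rw [map_zero]
    rfl
  mul_assoc x y z := (mul_act _ y z x).symm
  one_mul := one_mul_aux
  mul_one x := one_act _ x

/-- The direct limits are right modules over the residue field. -/
instance : Module (ResidueField H)ᵐᵒᵖ (Stalk H F) where
  smul x ξ := act F x.unop ξ
  one_smul ξ := one_act F ξ
  mul_smul x y ξ := mul_act F y.unop x.unop ξ
  smul_zero x := (act F x.unop).map_zero
  smul_add x := (act F x.unop).map_add
  add_smul x y ξ := by
    change act F (x.unop + y.unop) ξ = act F x.unop ξ + act F y.unop ξ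
    rw [map_add]
    rfl
  zero_smul ξ := by
    change act F 0 ξ = 0
    rw [map_zero]
    rfl

end ResidueField

/-- Functoriality in `F`, as a linear map over the residue field. -/
def Stalk.mapₗ {H : MonoformObject A} {F F' : Aᵒᵖ ⥤ AddCommGrpCat.{t}} [F.Additive]
    [F'.Additive] (φ : F ⟶ F') : Stalk H F →ₗ[(ResidueField H)ᵐᵒᵖ] Stalk H F' where
  __ := Stalk.map φ
  map_smul' x ξ := by
    obtain ⟨L, f, hf⟩ := ResidueField.exists_of x.unop
    change Stalk.map φ (ResidueField.act F x.unop ξ) =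
      ResidueField.act F' x.unop (Stalk.map φ ξ)
    rw [← hf, ResidueField.act_of, ResidueField.act_of, Stalk.map_pullEnd]

/-! ### Extension groups between atoms -/

variable [HasExt.{t} A]

/-- The contravariant functor `Ext^i(-, N)`. -/
abbrev extTo (i : ℕ) (N : A) : Aᵒᵖ ⥤ AddCommGrpCat.{t} := (Abelian.extFunctor i).flip.obj N

instance (i : ℕ) (N : A) : (extTo i N).Additive where
  map_add {X Y f g} := by
    have := congrArg (fun η => η.app N) ((Abelian.extFunctor (C := A) i).map_add (f := f) (g := g))
    exact this

/-- `Ext^i(α, N)`, the direct limit of `Ext^i(L, N)` over the nonzero subobjects `L` of the fixed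
representative of `α`; a right `k(α)`-module. -/
abbrev ExtAtomObj (i : ℕ) (α : ASpec A) (N : A) : Type (max t v u) :=
  Stalk α.rep (extTo i N)

/-- The canonical map `Ext^i(α, N) → Ext^i(α, N')` induced by `g : N ⟶ N'`. -/
abbrev ExtAtomObj.map (i : ℕ) (α : ASpec A) {N N' : A} (g : N ⟶ N') :
    ExtAtomObj i α N →ₗ[(ResidueField α.rep)ᵐᵒᵖ] ExtAtomObj i α N' :=
  Stalk.mapₗ ((Abelian.extFunctor i).flip.map g)

/-- `Ext^i(α, β)`, the inverse limit of `Ext^i(α, L)` over the nonzero subobjects `L` of the fixed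
representative of `β`. -/
def ExtAtom (i : ℕ) (α β : ASpec A) :
    Submodule (ResidueField α.rep)ᵐᵒᵖ
      (∀ L : NonzeroSub β.rep.obj, ExtAtomObj i α (L.1 : A)) where
  carrier := {x | ∀ (L M : NonzeroSub β.rep.obj) (h : M.1 ≤ L.1),
    ExtAtomObj.map i α (Subobject.ofLE M.1 L.1 h) (x M) = x L}
  add_mem' {x y} hx hy L M h := by
    rw [Pi.add_apply, Pi.add_apply, map_add, hx L M h, hy L M h]
  zero_mem' _ _ _ := map_zero _
  smul_mem' c x hx L M h := by
    rw [Pi.smul_apply, Pi.smul_apply, map_smul, hx L M h]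

/-- `D_α Ext^i(α, N)`, where `D_α` sends a right `k(α)`-module `V` to the left `k(α)`-module
`Hom_{k(α)}(V, k(α))`. -/
abbrev DualExt (i : ℕ) (α : ASpec A) (N : A) : Type (max t v u) :=
  ExtAtomObj i α N →ₗ[(ResidueField α.rep)ᵐᵒᵖ] ResidueField α.rep

/-- The map `D_α Ext^i(α, N') → D_α Ext^i(α, N)` induced by `g : N ⟶ N'`. -/
def DualExt.map (i : ℕ) (α : ASpec A) {N N' : A} (g : N ⟶ N') :
    DualExt i α N' →ₗ[ResidueField α.rep] DualExt i α N where
  toFun φ := φ.comp (ExtAtomObj.map i α g)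
  map_add' _ _ := rfl
  map_smul' _ _ := rfl

open scoped Classical in
/-- The virtual dual of `Ext^i(α, β)`: the direct limit of `D_α Ext^i(α, L)` over the nonzero
subobjects `L` of the fixed representative of `β`, directed by reverse inclusion. -/
abbrev VirtualDualExt (i : ℕ) (α β : ASpec A) : Type (max t v u) :=
  Module.DirectLimit (R := ResidueField α.rep) (ι := (NonzeroSub β.rep.obj)ᵒᵈ)
    (fun L => DualExt i α (L.ofDual.1 : A))
    (fun L M h => DualExt.map i α (Subobject.ofLE M.ofDual.1 L.ofDual.1 h))

/-- The inverse system defining `Ext^i(α, β)` is eventually constant. -/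
def IsEventuallyConstant (i : ℕ) (α β : ASpec A) : Prop :=
  ∃ L : NonzeroSub β.rep.obj, ∀ (L₁ L₂ : NonzeroSub β.rep.obj) (h : L₂.1 ≤ L₁.1), L₁.1 ≤ L.1 →
    Function.Bijective (ExtAtomObj.map i α (Subobject.ofLE L₂.1 L₁.1 h))

/-- The atoms `β` for which the inverse system defining `Ext^i(α, β)` is eventually constant and
its limit is nonzero. -/
def Const (i : ℕ) (α : ASpec A) : Set (ASpec A) :=
  {β | IsEventuallyConstant i α β ∧ Nontrivial (ExtAtom i α β)}

end AtomExt

end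

noncomputable section

namespace AtomExt

variable {A : Type u} [Category.{v} A] [Abelian A]

section ExtClass

/-! ### Degree one extension classes come from short exact sequences -/

/-! Classification. Supports are additive on short exact sequences (`ASupp_subset_union`), so
`ASuppInv Φ` is always a Serre subcategory. An open `Φ` is recovered because an atom of `Φ` has,
inside any monoform representative, a nonzero subobject supported in `Φ`
(`exists_mono_ASupp_subset`). A Serre subcategory `P` is recovered on noetherian objects: let `L` be
maximal among the subobjects of `M` lying in `P`. If `M / L` were nonzero it would contain a
monoform object; if the support of `M` comes from `P`, some nonzero subobject of that monoform lies
in `P`, and its preimage in `M` contradicts maximality. In the Grothendieck case every object is a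
quotient of the coproduct of its noetherian subobjects, and supports of coproducts are controlled by
finite subcoproducts.

Essential extensions. The five conditions form a cycle, each step about a class in Ext¹ restricted
to ever smaller subobjects of a monoform object. If `ASuppInv Φ` is closed under essential
extensions and `α ∉ Φ`, an extension of a subobject of the representative of `α` by `N` is never
essential over `N`, so it splits over a nonzero subobject: Ext¹(α, N) = 0. This gives the vanishing
of the limit and of the virtual dual, since subobjects supported in `Φ` are cofinal among the
nonzero subobjects of a representative of `β ∈ Φ`. Either vanishing excludes `β` from `Const 1 α`;
for the virtual dual one uses that `k(α)` is a skew field, so that linear forms separate points.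
Conversely, if Ext¹(α, N) ≠ 0 for a noetherian `N` supported in `Φ`, a minimal quotient `Q` of `N`
with Ext¹(α, Q) ≠ 0 has the same Ext¹(α, -) as each of its nonzero subobjects, so a monoform
subobject of `Q` yields an atom of `Const 1 α` in `Φ` (`exists_mem_const`). Hence disjointness gives
vanishing on noetherian objects, and `closedUnderEssentialExtensions_of_subsingleton` closes the
cycle.

Over a Grothendieck category injective envelopes exist, so closure under them is the same as closure
under essential extensions. -/

/-- A quasi-isomorphism from a complex `K` in degrees `≤ i` to an object in degree `i` is given by
an epimorphism in degree `i`, and this epimorphism lifts to `K`. -/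
lemma exists_epi_single_map_eq {X : A} {K : CochainComplex A ℤ} {i : ℤ} [K.IsStrictlyLE i]
    (π : K ⟶ (HomologicalComplex.single A (ComplexShape.up ℤ) i).obj X) [QuasiIso π] :
    ∃ (P : A) (f : P ⟶ X) (σ : (HomologicalComplex.single A (ComplexShape.up ℤ) i).obj P ⟶ K),
      Epi f ∧ (HomologicalComplex.single A (ComplexShape.up ℤ) i).map f = σ ≫ π := by
  let e := K.iCyclesIso i (i + 1) (by simp)
    ((K.isZero_of_isStrictlyLE i (i + 1) (by simp)).eq_of_tgt _ _)
  -- As `K` vanishes in degree `i + 1`, everything in degree `i` is a cycle; `f` is the projection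
  -- to homology followed by isomorphisms, hence epi.
  let f : K.X i ⟶ X := e.inv ≫ K.homologyπ i ≫ HomologicalComplex.homologyMap π i ≫
    (HomologicalComplex.singleObjHomologySelfIso _ _ _).hom
  have hf : π.f i = f ≫ (HomologicalComplex.singleObjXSelf (ComplexShape.up ℤ) i X).inv := by
    rw [← cancel_epi e.hom]
    have he : e.hom = K.iCycles i := rfl
    simp only [f]
    rw [Category.assoc, Category.assoc, Category.assoc, Iso.hom_inv_id_assoc, he,
      HomologicalComplex.homologyπ_naturality_assoc,
      HomologicalComplex.homologyπ_singleObjHomologySelfIso_hom_assoc,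
      ← HomologicalComplex.singleObjCyclesSelfIso_inv_iCycles, Iso.hom_inv_id_assoc,
      ← HomologicalComplex.cyclesMap_i]
  have hepi : Epi f := by
    have : IsIso (HomologicalComplex.homologyMap π i) := inferInstance
    exact epi_comp' inferInstance (epi_comp' inferInstance (epi_comp' inferInstance inferInstance))
  let σ : (HomologicalComplex.single A (ComplexShape.up ℤ) i).obj (K.X i) ⟶ K :=
    HomologicalComplex.mkHomFromSingle (𝟙 (K.X i)) (by
      rintro _ rfl
      apply (K.isZero_of_isStrictlyLE i (i + 1) (by simp)).eq_of_tgt)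
  refine ⟨K.X i, f, σ, hepi, ?_⟩
  apply HomologicalComplex.from_single_hom_ext
  rw [HomologicalComplex.comp_f, HomologicalComplex.mkHomFromSingle_f, hf, Category.comp_id,
    HomologicalComplex.single_map_f_self]

/-- Morphisms in the derived category from an object in degree `i` to a complex in degrees `< i`
are killed by an epimorphism. -/
lemma exists_epi_map_comp_eq_zero [HasDerivedCategory.{w} A] {X : A} {L : CochainComplex A ℤ}
    {i : ℤ}
    (φ : DerivedCategory.Q.obj ((HomologicalComplex.single A (ComplexShape.up ℤ) i).obj X) ⟶
      DerivedCategory.Q.obj L) (n : ℤ) (hn : n < i) [L.IsStrictlyLE n] :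
    ∃ (P : A) (f : P ⟶ X), Epi f ∧
      DerivedCategory.Q.map ((HomologicalComplex.single A (ComplexShape.up ℤ) i).map f) ≫ φ = 0 := by
  have : CochainComplex.IsStrictlyLE
      ((HomologicalComplex.single A (ComplexShape.up ℤ) i).obj X) i :=
    inferInstanceAs (((CochainComplex.singleFunctor A i).obj X).IsStrictlyLE i)
  -- Write `φ` as a fraction with denominator `π`. Lifting `P` through `π` reduces the composite to
  -- a chain map from degree `i` to a complex that is zero there.
  obtain ⟨K, _, π, h, g, rfl⟩ := DerivedCategory.right_fac_of_isStrictlyLE φ i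
  have hπ : QuasiIso π := by rwa [DerivedCategory.isIso_Q_map_iff_quasiIso] at h
  obtain ⟨P, f, σ, hf, hσ⟩ := exists_epi_single_map_eq π
  have h₂ : σ ≫ g = 0 := by
    apply HomologicalComplex.from_single_hom_ext
    apply (L.isZero_of_isStrictlyLE n i hn).eq_of_tgt
  refine ⟨P, f, hf, ?_⟩
  rw [hσ, Functor.map_comp, Category.assoc, IsIso.hom_inv_id_assoc, ← Functor.map_comp, h₂,
    Functor.map_zero]

variable [HasExt.{t} A]

/-- The class is a morphism from `X` to a shift of `Y`, and the shift places `Y` in degree `-(n +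
1)`, strictly below `X`. -/
lemma exists_epi_mk₀_comp_eq_zero {X Y : A} {n : ℕ} (ξ : Abelian.Ext.{t} X Y (n + 1)) :
    ∃ (P : A) (f : P ⟶ X), Epi f ∧ (Abelian.Ext.mk₀ f).comp ξ (zero_add (n + 1)) = 0 := by
  let := HasDerivedCategory.standard A
  let s := ((DerivedCategory.singleFunctors A).shiftIso (n + 1) (-(n + 1)) 0
    (by lia)).hom.app Y
  obtain ⟨P, f, hf, h⟩ := exists_epi_map_comp_eq_zero
    (L := (CochainComplex.singleFunctor A (-(n + 1))).obj Y) (i := 0) (X := X)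
    (ξ.hom ≫ s) (-(n + 1)) (by lia)
  refine ⟨P, f, hf, ?_⟩
  apply Abelian.Ext.homEquiv.injective
  rw [← cancel_mono s]
  simp only [Abelian.Ext.comp_hom, Abelian.Ext.mk₀_hom, Abelian.Ext.zero_hom, ShiftedHom.mk₀_comp,
    Limits.zero_comp, Category.assoc]
  exact h

/-- Every class in `Ext¹(X, Y)` is the class of a short exact sequence `0 ⟶ Y ⟶ E ⟶ X ⟶ 0`. -/
lemma exists_extClass_eq {X Y : A} (ξ : Abelian.Ext.{t} X Y 1) :
    ∃ (E : A) (i : Y ⟶ E) (p : E ⟶ X) (w : i ≫ p = 0)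
      (hS : (ShortComplex.mk i p w).ShortExact), hS.extClass = ξ := by
  -- Since `ξ` dies on `P`, it is the image of some `g : kernel f ⟶ Y` under the connecting map; the
  -- extension sought is the pushout of `0 ⟶ kernel f ⟶ P ⟶ X ⟶ 0` along `g`.
  obtain ⟨P, f, hf, h⟩ := exists_epi_mk₀_comp_eq_zero (n := 0) ξ
  have hS : (ShortComplex.mk (kernel.ι f) f (kernel.condition f)).ShortExact :=
    { exact := ShortComplex.exact_of_f_is_kernel _ (kernelIsKernel f) }
  obtain ⟨x, hx⟩ := Abelian.Ext.contravariant_sequence_exact₃ hS Y ξ h (add_zero 1)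
  obtain ⟨g, rfl⟩ := (Abelian.Ext.mk₀_bijective (kernel f) Y).2 x
  let p : pushout (kernel.ι f) g ⟶ X := pushout.desc f 0 (by simp)
  have hp : pushout.inl (kernel.ι f) g ≫ p = f := pushout.inl_desc _ _ _
  have hp' : pushout.inr (kernel.ι f) g ≫ p = 0 := pushout.inr_desc _ _ _
  have hepi : Epi p := epi_of_epi_fac hp
  have hS' : (ShortComplex.mk (pushout.inr (kernel.ι f) g) p hp').ShortExact :=
    { exact := by
        apply ShortComplex.exact_of_g_is_cokernel
        refine CokernelCofork.IsColimit.ofπ' _ _ fun {T} k hk => ?_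
        have hk' : kernel.ι f ≫ pushout.inl (kernel.ι f) g ≫ k = 0 := by
          rw [pushout.condition_assoc]
          dsimp at hk
          rw [hk, comp_zero]
        refine ⟨Abelian.epiDesc f _ hk', ?_⟩
        apply pushout.hom_ext
        · dsimp
          rw [reassoc_of% hp, Abelian.comp_epiDesc]
        · dsimp at hk ⊢
          rw [reassoc_of% hp', zero_comp, hk]
      mono_f := by dsimp; infer_instance }
  refine ⟨_, _, p, hp', hS', ?_⟩
  let φ : ShortComplex.mk (kernel.ι f) f (kernel.condition f) ⟶
      ShortComplex.mk (pushout.inr (kernel.ι f) g) p hp' :=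
    { τ₁ := g
      τ₂ := pushout.inl _ _
      τ₃ := 𝟙 X
      comm₁₂ := pushout.condition.symm
      comm₂₃ := by simp [hp] }
  have h2 := ShortComplex.ShortExact.extClass_naturality hS hS' φ
  rw [← hx]
  refine Eq.trans ?_ h2.symm
  exact (Abelian.Ext.mk₀_id_comp _).symm

end ExtClass

/-! ### Monoform objects and atom supports -/

lemma isZero_of_comp_eq_zero {X Y Z : A} (f : X ⟶ Y) (g : Y ⟶ Z) [Epi f] [Mono g]
    (h : f ≫ g = 0) : IsZero Y := by
  have hg : g = 0 := by rw [← cancel_epi f, h, comp_zero]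
  exact IsZero.of_mono_eq_zero g hg

lemma not_isZero_image {X Y : A} {f : X ⟶ Y} (hf : f ≠ 0) : ¬ IsZero (image f) := fun h =>
  hf (by rw [← image.fac f, h.eq_of_src (image.ι f) 0, comp_zero])

lemma id_ne_zero_of_not_isZero {X : A} (hX : ¬ IsZero X) : 𝟙 X ≠ 0 := fun h =>
  hX ((IsZero.iff_id_eq_zero X).2 h)

lemma epi_ne_zero {X Y : A} (f : X ⟶ Y) [Epi f] (hY : ¬ IsZero Y) : f ≠ 0 := fun h =>
  hY (IsZero.of_epi_eq_zero f h)

lemma mono_ne_zero {X Y : A} (f : X ⟶ Y) [Mono f] (hX : ¬ IsZero X) : f ≠ 0 := fun h =>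
  hX (IsZero.of_mono_eq_zero f h)

lemma comp_mono_ne_zero {X Y Z : A} {f : X ⟶ Y} (hf : f ≠ 0) (g : Y ⟶ Z) [Mono g] :
    f ≫ g ≠ 0 := fun h => hf (by rw [← cancel_mono g, h, zero_comp])

lemma epi_comp_ne_zero {X Y Z : A} (f : X ⟶ Y) [Epi f] {g : Y ⟶ Z} (hg : g ≠ 0) :
    f ≫ g ≠ 0 := fun h => hg (by rw [← cancel_epi f, h, comp_zero])

/-- An object is monoform iff it is nonzero and every nonzero morphism to it from one of its
subobjects is a monomorphism. -/
lemma isMonoform_iff {H : A} : IsMonoform H ↔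
    ¬ IsZero H ∧ ∀ ⦃X : A⦄ (i f : X ⟶ H), Mono i → f ≠ 0 → Mono f := by
  refine ⟨fun h => ⟨h.not_isZero, fun X i f _ hf => h.mono_of_ne_zero i f hf⟩, fun ⟨h, h'⟩ =>
    ⟨h, fun L' L N hle hL' _ hN => ⟨fun e => ?_⟩⟩⟩
  let f : (L : A) ⟶ H := cokernel.π (Subobject.ofLE L' L hle) ≫ e.hom ≫ N.arrow
  have hf : f ≠ 0 :=
    epi_comp_ne_zero _ (mono_ne_zero _ fun h0 => not_isZero_of_ne_bot hN (h0.of_iso e.symm))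
  have hm := h' L.arrow f inferInstance hf
  apply not_isZero_of_ne_bot hL'
  apply IsZero.of_mono_eq_zero (Subobject.ofLE L' L hle ≫ f)
  simp [f]

lemma IsMonoform.of_mono {X H : A} (hH : IsMonoform H) (j : X ⟶ H) [Mono j] (hX : ¬ IsZero X) :
    IsMonoform X := by
  refine isMonoform_iff.2 ⟨hX, fun Y i f _ hf => ?_⟩
  have := (isMonoform_iff.1 hH).2 (i ≫ j) (f ≫ j) inferInstance (comp_mono_ne_zero hf j)
  exact mono_of_mono f j

/-- A nonzero noetherian object has a monoform subobject. -/
lemma exists_isMonoform_of_isNoetherianObject {M : A} [IsNoetherianObject M] (hM : ¬ IsZero M) :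
    ∃ (H : A) (j : H ⟶ M), Mono j ∧ IsMonoform H := by
  -- Kernels of nonzero morphisms to `M` defined on subobjects of `M`. A morphism whose kernel is
  -- maximal among these has monoform image.
  let s : Set (Subobject M) := {K | ∃ (X : A) (i g : X ⟶ M) (_ : Mono i), g ≠ 0 ∧
    K = Subobject.mk (kernel.ι g ≫ i)}
  obtain ⟨K, ⟨X, i, g, hi, hg, rfl⟩, hK⟩ := (wellFounded_gt (α := Subobject M)).has_min s
    ⟨_, M, 𝟙 M, 𝟙 M, inferInstance, id_ne_zero_of_not_isZero hM, rfl⟩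
  refine ⟨image g, image.ι g, inferInstance, isMonoform_iff.2 ⟨not_isZero_image hg, ?_⟩⟩
  intro Y a f ha hf
  let b := pullback.fst (factorThruImage g) a
  let q := pullback.snd (factorThruImage g) a
  have hbq : b ≫ factorThruImage g = q ≫ a := pullback.condition
  have hq : Epi q := Abelian.epi_pullback_of_epi_f _ _
  have hb : Mono b := pullback.fst_of_mono
  -- `f` transported to the preimage of `Y` in `X`. Its kernel contains that of `g`, so by
  -- maximality the two agree, which says that `f` kills nothing.
  let g' := q ≫ f ≫ image.ι g
  have hg' : g' ≠ 0 := epi_comp_ne_zero _ (comp_mono_ne_zero hf _)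
  have hle : Subobject.mk (kernel.ι g ≫ i) ≤ Subobject.mk (kernel.ι g' ≫ b ≫ i) := by
    have h0 : kernel.ι g ≫ factorThruImage g = 0 := by
      rw [← cancel_mono (image.ι g)]
      simp
    refine Subobject.mk_le_mk_of_comm (kernel.lift g' (pullback.lift (kernel.ι g) 0
      (by rw [h0, zero_comp])) ?_) ?_
    · simp only [g', q, pullback.lift_snd_assoc, zero_comp]
    · rw [kernel.lift_ι_assoc, pullback.lift_fst_assoc]
  have hge : Subobject.mk (kernel.ι g' ≫ b ≫ i) ≤ Subobject.mk (kernel.ι g ≫ i) := by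
    by_contra hlt
    exact hK _ ⟨_, b ≫ i, g', inferInstance, hg', rfl⟩ (lt_of_le_not_ge hle hlt)
  apply Preadditive.mono_of_cancel_zero
  intro Z z hz
  have hx : pullback.fst q z ≫ g' = 0 := by
    simp only [g', pullback.condition_assoc, reassoc_of% hz, zero_comp, comp_zero]
  have hx2 : pullback.fst q z ≫ b = (kernel.lift g' _ hx ≫ Subobject.ofMkLEMk _ _ hge) ≫
      kernel.ι g := by
    rw [← cancel_mono i]
    simp
  have h0 : kernel.ι g ≫ factorThruImage g = 0 := by
    rw [← cancel_mono (image.ι g)]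
    simp
  rw [← cancel_epi (pullback.snd q z), ← cancel_mono a, ← pullback.condition, Category.assoc,
    ← hbq, reassoc_of% hx2, h0]
  simp

/-! ### Atoms and atom supports through nonzero morphisms -/

lemma atom_eq_iff {H₁ H₂ : MonoformObject A} : (Quotient.mk _ H₁ : ASpec A) = Quotient.mk _ H₂ ↔
    ∃ (X : A) (i₁ : X ⟶ H₁.obj) (i₂ : X ⟶ H₂.obj), Mono i₁ ∧ Mono i₂ ∧ ¬ IsZero X := by
  constructor
  · intro h
    obtain ⟨L₁, L₂, h₁, h₂, ⟨e⟩⟩ := Quotient.exact h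
    exact ⟨_, L₁.arrow, e.hom ≫ L₂.arrow, inferInstance, inferInstance, not_isZero_of_ne_bot h₁⟩
  · rintro ⟨X, i₁, i₂, _, _, hX⟩
    exact Quotient.sound ⟨Subobject.mk i₁, Subobject.mk i₂, mk_ne_bot _ hX, mk_ne_bot _ hX,
      ⟨Subobject.underlyingIso _ ≪≫ (Subobject.underlyingIso _).symm⟩⟩

lemma ASpec.mk_rep (α : ASpec A) : (Quotient.mk _ α.rep : ASpec A) = α := Quotient.out_eq α

/-- The atom of `H` lies in the support of `M` iff some subobject of `M` has a nonzero morphism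
to `H`. -/
lemma mem_ASupp_iff {H : MonoformObject A} {M : A} : (Quotient.mk _ H : ASpec A) ∈ ASupp M ↔
    ∃ (X : A) (i : X ⟶ M) (p : X ⟶ H.obj), Mono i ∧ p ≠ 0 := by
  constructor
  · rintro ⟨H', h, X, i, p, _, _⟩
    obtain ⟨Z, z', z, _, _, hZ⟩ := atom_eq_iff.1 h
    have : Epi (pullback.snd p z') := Abelian.epi_pullback_of_epi_f _ _
    have : Mono (pullback.fst p z') := pullback.fst_of_mono
    exact ⟨_, pullback.fst p z' ≫ i, pullback.snd p z' ≫ z, inferInstance,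
      comp_mono_ne_zero (epi_ne_zero _ hZ) z⟩
  · rintro ⟨X, i, p, hi, hp⟩
    refine ⟨⟨image p, H.isMonoform.of_mono (image.ι p) (not_isZero_image hp)⟩,
      atom_eq_iff.2 ⟨image p, 𝟙 _, image.ι p, inferInstance, inferInstance, not_isZero_image hp⟩,
      X, i, factorThruImage p, hi, inferInstance⟩

lemma mem_ASupp_iff_rep {α : ASpec A} {M : A} : α ∈ ASupp M ↔
    ∃ (X : A) (i : X ⟶ M) (p : X ⟶ α.rep.obj), Mono i ∧ p ≠ 0 := by
  refine Iff.trans ?_ mem_ASupp_iff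
  rw [α.mk_rep]
  exact Iff.rfl

lemma mem_ASupp_self (H : MonoformObject A) : (Quotient.mk _ H : ASpec A) ∈ ASupp H.obj :=
  mem_ASupp_iff.2 ⟨_, 𝟙 _, 𝟙 _, inferInstance, id_ne_zero_of_not_isZero H.isMonoform.not_isZero⟩

lemma ASupp_subset_of_mono {M N : A} (f : M ⟶ N) [Mono f] : ASupp M ⊆ ASupp N := by
  rintro α ⟨H, h, X, i, p, _, hp⟩
  exact ⟨H, h, X, i ≫ f, p, inferInstance, hp⟩

lemma ASupp_subset_of_epi {M N : A} (f : M ⟶ N) [Epi f] : ASupp N ⊆ ASupp M := by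
  rintro α ⟨H, h, X, i, p, _, hp⟩
  have : Epi (pullback.snd f i) := Abelian.epi_pullback_of_epi_f _ _
  have : Mono (pullback.fst f i) := pullback.fst_of_mono
  exact ⟨H, h, _, pullback.fst f i, pullback.snd f i ≫ p, inferInstance, inferInstance⟩

/-- Given `X ⊆ S.X₂` and a nonzero `p` from `X` to the representative, either `p` is nonzero on the
part of `X` inside `S.X₁`, or it factors through the image of `X` in `S.X₃`. -/
lemma ASupp_subset_union {S : ShortComplex A} (hS : S.ShortExact) :
    ASupp S.X₂ ⊆ ASupp S.X₁ ∪ ASupp S.X₃ := by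
  intro α hα
  obtain ⟨X, i, p, hi, hp⟩ := mem_ASupp_iff_rep.1 hα
  have := hS.mono_f
  by_cases h : kernel.ι (i ≫ S.g) ≫ p = 0
  · right
    have hk : kernel.ι (factorThruImage (i ≫ S.g)) ≫ p = 0 := by
      have h0 : kernel.ι (factorThruImage (i ≫ S.g)) ≫ i ≫ S.g = 0 := by
        have h1 := kernel.condition (factorThruImage (i ≫ S.g)) =≫ image.ι (i ≫ S.g)
        rwa [Category.assoc, image.fac, zero_comp] at h1
      rw [← kernel.lift_ι (i ≫ S.g) _ h0, Category.assoc, h, comp_zero]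
    refine mem_ASupp_iff_rep.2 ⟨_, image.ι (i ≫ S.g),
      Abelian.epiDesc (factorThruImage (i ≫ S.g)) p hk, inferInstance, fun h0 => hp ?_⟩
    rw [← Abelian.comp_epiDesc (factorThruImage (i ≫ S.g)) p hk, h0, comp_zero]
  · left
    have hk : (kernel.ι (i ≫ S.g) ≫ i) ≫ S.g = 0 := by simp
    have h2 := hS.exact.lift_f (kernel.ι (i ≫ S.g) ≫ i) hk
    have : Mono (hS.exact.lift (kernel.ι (i ≫ S.g) ≫ i) hk) := by
      have : Mono (hS.exact.lift (kernel.ι (i ≫ S.g) ≫ i) hk ≫ S.f) := by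
        rw [h2]; infer_instance
      exact mono_of_mono _ S.f
    exact mem_ASupp_iff_rep.2 ⟨_, hS.exact.lift _ hk, _, this, h⟩

lemma not_mem_ASupp_of_isZero {M : A} (hM : IsZero M) (α : ASpec A) : α ∉ ASupp M := by
  intro h
  obtain ⟨X, i, p, hi, hp⟩ := mem_ASupp_iff_rep.1 h
  have : IsZero X := IsZero.of_mono_eq_zero i (hM.eq_of_tgt _ _)
  exact hp (this.eq_of_src _ _)

instance isSerreClass_ASuppInv (Φ : Set (ASpec A)) : (ASuppInv Φ).IsSerreClass where
  exists_zero := ⟨_, isZero_zero A, fun α h =>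
    (not_mem_ASupp_of_isZero (isZero_zero A) α h).elim⟩
  prop_of_mono f _ hY := (ASupp_subset_of_mono f).trans hY
  prop_of_epi f _ hX := (ASupp_subset_of_epi f).trans hX
  prop_X₂_of_shortExact hS h₁ h₃ := (ASupp_subset_union hS).trans (Set.union_subset h₁ h₃)

/-! ### The topology -/

lemma isOpen_ASupp (M : A) : IsOpen (ASupp M) :=
  TopologicalSpace.isOpen_generateFrom_of_mem ⟨M, rfl⟩

lemma isOpen_ASuppOf (S : ObjectProperty A) : IsOpen (ASuppOf S) :=
  isOpen_iUnion fun M => isOpen_iUnion fun _ => isOpen_ASupp M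

/-- The supports of the nonzero subobjects of a monoform object are a neighbourhood basis of
its atom. -/
lemma exists_mono_ASupp_subset {Φ : Set (ASpec A)} (hΦ : IsOpen Φ) (H : MonoformObject A)
    (hH : (Quotient.mk _ H : ASpec A) ∈ Φ) :
    ∃ (X : A) (i : X ⟶ H.obj), Mono i ∧ ¬ IsZero X ∧ ASupp X ⊆ Φ := by
  induction hΦ with
  | basic s hs =>
    obtain ⟨M, rfl⟩ := hs
    obtain ⟨Y, i, p, hi, hp⟩ := mem_ASupp_iff.1 hH
    exact ⟨image p, image.ι p, inferInstance, not_isZero_image hp,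
      (ASupp_subset_of_epi (factorThruImage p)).trans (ASupp_subset_of_mono i)⟩
  | univ => exact ⟨_, 𝟙 _, inferInstance, H.isMonoform.not_isZero, Set.subset_univ _⟩
  | inter s t _ _ hs ht =>
    obtain ⟨X, i, _, hX, hXs⟩ := hs hH.1
    obtain ⟨Y, j, _, hY, hYt⟩ := ht hH.2
    let L := Subobject.mk i ⊓ Subobject.mk j
    have hL : L ≠ ⊥ := H.isMonoform.inf_ne_bot (mk_ne_bot i hX) (mk_ne_bot j hY)
    exact ⟨_, L.arrow, inferInstance, not_isZero_of_ne_bot hL, Set.subset_inter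
      ((ASupp_subset_of_mono (Subobject.ofLEMk L i inf_le_left)).trans hXs)
      ((ASupp_subset_of_mono (Subobject.ofLEMk L j inf_le_right)).trans hYt)⟩
  | sUnion S _ hS =>
    obtain ⟨s, hs, hHs⟩ := hH
    obtain ⟨X, i, hi, hX, h⟩ := hS s hs hHs
    exact ⟨X, i, hi, hX, h.trans (Set.subset_sUnion_of_mem hs)⟩

/-- Cofinality: limits over the nonzero subobjects of the representative may be tested on those
supported in `Φ`. -/
lemma exists_nonzeroSub_ASuppInv {Φ : Set (ASpec A)} (hΦ : IsOpen Φ) {β : ASpec A} (hβ : β ∈ Φ)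
    (L : NonzeroSub β.rep.obj) :
    ∃ M : NonzeroSub β.rep.obj, M.1 ≤ L.1 ∧ ASuppInv Φ (M.1 : A) := by
  obtain ⟨X, i, _, hX, hXΦ⟩ := exists_mono_ASupp_subset hΦ β.rep (by rwa [β.mk_rep])
  refine ⟨⟨L.1 ⊓ Subobject.mk i, β.rep.isMonoform.inf_ne_bot L.2 (mk_ne_bot i hX)⟩,
    inf_le_left, ?_⟩
  exact (ASuppInv Φ).prop_of_mono (Subobject.ofLEMk _ i inf_le_right) hXΦ

lemma ASuppOf_ASuppInv {Φ : Set (ASpec A)} (hΦ : IsOpen Φ) : ASuppOf (ASuppInv Φ) = Φ := by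
  apply Set.Subset.antisymm
  · exact Set.iUnion₂_subset fun M hM => hM
  · intro α hα
    obtain ⟨X, i, _, hX, h⟩ := exists_mono_ASupp_subset hΦ α.rep (by rwa [α.mk_rep])
    refine Set.mem_iUnion₂.2 ⟨X, h, mem_ASupp_iff_rep.2 ⟨X, 𝟙 X, i, inferInstance,
      mono_ne_zero i hX⟩⟩

/-! ### Noetherian objects -/

/-- Taking preimages along an epimorphism reflects inclusions of subobjects, so ascending chains in
`Y` stabilize when their preimages in `X` do. -/
lemma isNoetherianObject_of_epi {X Y : A} (f : X ⟶ Y) [Epi f] [IsNoetherianObject X] :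
    IsNoetherianObject Y := by
  have hinj : ∀ L M : Subobject Y, (Subobject.pullback f).obj L ≤ (Subobject.pullback f).obj M →
      L ≤ M := by
    intro L M h
    have hL : Epi (pullback.snd f L.arrow) := Abelian.epi_pullback_of_epi_f _ _
    have hfac : ((Subobject.pullback f).obj L).Factors (pullback.fst f L.arrow) :=
      pullback_factors _ _ _ (by
        rw [pullback.condition]
        exact Subobject.factors_comp_arrow _)
    have hfac2 : M.Factors (pullback.snd f L.arrow ≫ L.arrow) := by
      rw [← pullback.condition]
      exact (pullback_factors_iff _ _ _).1 (Subobject.factors_of_le _ h hfac)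
    have hk : (pullback.snd f L.arrow ≫ L.arrow) ≫ cokernel.π M.arrow = 0 := by
      rw [← M.factorThru_arrow _ hfac2, Category.assoc, cokernel.condition, comp_zero]
    have hk2 : L.arrow ≫ cokernel.π M.arrow = 0 := by
      rw [← cancel_epi (pullback.snd f L.arrow), comp_zero, ← Category.assoc, hk]
    exact Subobject.le_of_comm (Abelian.monoLift M.arrow L.arrow hk2)
      (Abelian.monoLift_comp _ _ _)
  rw [isNoetherianObject_iff_monotone_chain_condition]
  intro g
  obtain ⟨n, hn⟩ := monotone_chain_condition_of_isNoetherianObject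
    ⟨_, (Subobject.pullback f).monotone.comp g.2⟩
  exact ⟨n, fun m hm => le_antisymm (hinj _ _ (hn m hm).le) (hinj _ _ (hn m hm).ge)⟩

variable (A) in
/-- Nonzero morphisms are detected by noetherian objects. -/
def IsLocallyNoetherian : Prop :=
  ∀ ⦃X Y : A⦄ (f : X ⟶ Y), f ≠ 0 → ∃ (U : A) (g : U ⟶ X), IsNoetherianObject U ∧ g ≫ f ≠ 0

lemma HasNoetherianGenerators.isLocallyNoetherian (h : HasNoetherianGenerators.{w} A) :
    IsLocallyNoetherian A := by
  obtain ⟨ι, U, hU, h⟩ := h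
  intro X Y f hf
  obtain ⟨i, g, hg⟩ := h f hf
  exact ⟨U i, g, hU i, hg⟩

lemma isLocallyNoetherian_of_noetherian [Noetherian.{v, u, w} A] : IsLocallyNoetherian A :=
  fun X _ f hf => ⟨X, 𝟙 X, inferInstance, by simpa⟩

/-- Nonzero morphisms are detected by noetherian subobjects. -/
lemma IsLocallyNoetherian.exists_mono (hA : IsLocallyNoetherian A) {X Y : A} (f : X ⟶ Y)
    (hf : f ≠ 0) : ∃ (U : A) (g : U ⟶ X), Mono g ∧ IsNoetherianObject U ∧ g ≫ f ≠ 0 := by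
  obtain ⟨U, g, hU, hg⟩ := hA f hf
  refine ⟨image g, image.ι g, inferInstance, isNoetherianObject_of_epi (factorThruImage g),
    fun h => hg ?_⟩
  rw [← image.fac g, Category.assoc, h, comp_zero]

/-! ### Essential monomorphisms -/

/-- Passes from meets in the subobject lattice to pullbacks, the form in which essentiality is
handled below. -/
lemma isZero_pullback_iff {M E Z : A} (i : M ⟶ E) [Mono i] (z : Z ⟶ E) [Mono z] :
    IsZero (pullback i z) ↔ Subobject.mk i ⊓ Subobject.mk z = ⊥ := by
  constructor
  · intro h
    by_contra hL
    let L := Subobject.mk i ⊓ Subobject.mk z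
    apply not_isZero_of_ne_bot hL
    have h1 : L.arrow = pullback.lift (Subobject.ofLEMk L i inf_le_left)
        (Subobject.ofLEMk L z inf_le_right) (by simp) ≫ pullback.fst i z ≫ i := by
      rw [pullback.lift_fst_assoc, Subobject.ofLEMk_comp]
    apply IsZero.of_mono_eq_zero L.arrow
    rw [h1, h.eq_of_src (pullback.fst i z ≫ i) 0, comp_zero]
  · intro h
    have hfac : (Subobject.mk i ⊓ Subobject.mk z).Factors (pullback.fst i z ≫ i) := by
      rw [Subobject.inf_factors]
      refine ⟨(Subobject.mk_factors_iff _ _).2 ⟨pullback.fst i z, rfl⟩,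
        (Subobject.mk_factors_iff _ _).2 ⟨pullback.snd i z, pullback.condition.symm⟩⟩
    rw [h, Subobject.bot_factors_iff_zero] at hfac
    have : Mono (pullback.fst i z) := pullback.fst_of_mono
    exact IsZero.of_mono_eq_zero _ hfac

lemma isEssentialMono_iff_pullback {M E : A} (i : M ⟶ E) [Mono i] : IsEssentialMono i ↔
    ∀ ⦃Z : A⦄ (z : Z ⟶ E), Mono z → IsZero (pullback i z) → IsZero Z := by
  constructor
  · intro h Z z _ hZ
    by_contra h0
    exact h _ (mk_ne_bot z h0) ((isZero_pullback_iff i z).1 hZ)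
  · intro h L hL h0
    apply not_isZero_of_ne_bot hL
    apply h L.arrow inferInstance
    rwa [isZero_pullback_iff, Subobject.mk_arrow]

/-- By `hp`, whatever `p` kills comes from `M`, and `Z` meets `M` in zero. -/
lemma mono_comp_of_isZero_pullback {M E Z : A} (i : M ⟶ E) (z : Z ⟶ E) [Mono z]
    (h : IsZero (pullback i z)) {Q : A} (p : E ⟶ Q)
    (hp : ∀ ⦃T : A⦄ (x : T ⟶ E), x ≫ p = 0 → ∃ y : T ⟶ M, y ≫ i = x) : Mono (z ≫ p) := by
  apply Preadditive.mono_of_cancel_zero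
  intro T x hx
  obtain ⟨y, hy⟩ := hp (x ≫ z) (by simpa using hx)
  rw [← pullback.lift_snd (f := i) (g := z) y x hy, h.eq_of_src (pullback.snd i z) 0, comp_zero]

lemma IsEssentialMono.mono_of_mono {M E : A} {i : M ⟶ E} [Mono i] (hi : IsEssentialMono i)
    {Y : A} (f : E ⟶ Y) [Mono (i ≫ f)] : Mono f := by
  apply Preadditive.mono_of_kernel_zero
  apply IsZero.eq_of_src
  apply (isEssentialMono_iff_pullback i).1 hi (kernel.ι f) inferInstance
  have : Mono (pullback.fst i (kernel.ι f)) := pullback.fst_of_mono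
  apply IsZero.of_mono_eq_zero (pullback.fst i (kernel.ι f))
  rw [← cancel_mono (i ≫ f), pullback.condition_assoc]
  simp

/-- Test on `E ⟶ E / Z`: if `Z` misses `M`, this is mono on `M`, hence mono, so `Z` is zero.
Together with `IsEssentialMono.mono_of_mono` this makes compositions formal. -/
lemma isEssentialMono_of_forall_mono {M E : A} {i : M ⟶ E} [Mono i]
    (h : ∀ ⦃Y : A⦄ (f : E ⟶ Y), Mono (i ≫ f) → Mono f) : IsEssentialMono i := by
  rw [isEssentialMono_iff_pullback]
  intro Z z _ hZ
  have hm : Mono (i ≫ cokernel.π z) := by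
    apply Preadditive.mono_of_cancel_zero
    intro T x hx
    have hx' : (x ≫ i) ≫ cokernel.π z = 0 := by simpa using hx
    rw [← pullback.lift_fst (f := i) (g := z) x (Abelian.monoLift z _ hx') (by simp),
      hZ.eq_of_src (pullback.fst i z) 0, comp_zero]
  have := h _ hm
  apply IsZero.of_mono_eq_zero z
  rw [← cancel_mono (cokernel.π z), cokernel.condition, zero_comp]

lemma IsEssentialMono.comp {M E F : A} {i : M ⟶ E} {j : E ⟶ F} [Mono i] [Mono j]
    (hi : IsEssentialMono i) (hj : IsEssentialMono j) : IsEssentialMono (i ≫ j) := by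
  apply isEssentialMono_of_forall_mono
  intro Y f hf
  rw [Category.assoc] at hf
  have := hi.mono_of_mono (j ≫ f)
  exact hj.mono_of_mono f

lemma IsEssentialMono.of_comp {M E F : A} {i : M ⟶ E} {j : E ⟶ F} [Mono i] [Mono j]
    (h : IsEssentialMono (i ≫ j)) : IsEssentialMono j := by
  apply isEssentialMono_of_forall_mono
  intro Y f hf
  have : Mono ((i ≫ j) ≫ f) := by rw [Category.assoc]; infer_instance
  exact h.mono_of_mono f

lemma IsEssentialMono.pullback_snd {M E U : A} {i : M ⟶ E} [Mono i] (hi : IsEssentialMono i)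
    (u : U ⟶ E) [Mono u] : IsEssentialMono (pullback.snd i u) := by
  rw [isEssentialMono_iff_pullback] at hi ⊢
  intro Z z _ hZ
  apply hi (z ≫ u) inferInstance
  let g : pullback i (z ≫ u) ⟶ pullback (pullback.snd i u) z :=
    pullback.lift (pullback.lift (pullback.fst _ _) (pullback.snd _ _ ≫ z)
      (by rw [pullback.condition, Category.assoc])) (pullback.snd _ _)
      (pullback.lift_snd _ _ _)
  have hg : pullback.snd i (z ≫ u) = g ≫ pullback.snd (pullback.snd i u) z :=
    (pullback.lift_snd _ _ _).symm
  have : Mono (pullback.snd i (z ≫ u)) := pullback.snd_of_mono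
  apply IsZero.of_mono_eq_zero (pullback.snd i (z ≫ u))
  rw [hg, hZ.eq_of_src (pullback.snd (pullback.snd i u) z) 0, comp_zero]

/-! ### Serre subcategories and their supports -/

lemma prop_of_prop_kernel_of_prop {P : ObjectProperty A} [P.IsSerreClass] {Y X : A} (q : Y ⟶ X)
    (h₁ : P (kernel q)) (h₂ : P X) : P Y := by
  have hS : (ShortComplex.mk (kernel.ι q) (factorThruImage q) (by
      rw [← cancel_mono (image.ι q)]; simp)).ShortExact :=
    { exact := by
        apply ShortComplex.exact_of_f_is_kernel
        exact isKernelOfComp (image.ι q) q (kernelIsKernel q) _ (image.fac q) }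
  exact P.prop_X₂_of_shortExact hS h₁ (P.prop_of_mono (image.ι q) h₂)

/-- A noetherian object `M` has a subobject `L` in a given Serre subcategory such that no nonzero
subobject of `M / L` lies in that subcategory. -/
lemma exists_prop_subobject {P : ObjectProperty A} [P.IsSerreClass] (M : A)
    [IsNoetherianObject M] : ∃ L : Subobject M, P (L : A) ∧
      ∀ ⦃X : A⦄ (j : X ⟶ cokernel L.arrow), Mono j → P X → IsZero X := by
  obtain ⟨L, hL, hmax⟩ := (wellFounded_gt (α := Subobject M)).has_min {L | P (L : A)}
    ⟨⊥, P.prop_of_isZero (IsZero.of_mono_eq_zero (⊥ : Subobject M).arrow (by simp))⟩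
  refine ⟨L, hL, fun X j _ hX => ?_⟩
  -- The preimage of `X` in `M` contains `L` and is an extension of `X` by an object embedded in
  -- `L`, so it lies in `P` and equals `L`.
  let b := pullback.fst (cokernel.π L.arrow) j
  let q := pullback.snd (cokernel.π L.arrow) j
  have hbq : b ≫ cokernel.π L.arrow = q ≫ j := pullback.condition
  have hb : Mono b := pullback.fst_of_mono
  have hq : Epi q := Abelian.epi_pullback_of_epi_f _ _
  have hk : (kernel.ι q ≫ b) ≫ cokernel.π L.arrow = 0 := by
    rw [Category.assoc, hbq, kernel.condition_assoc, zero_comp]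
  have hm : Mono (Abelian.monoLift L.arrow _ hk) := by
    have : Mono (Abelian.monoLift L.arrow _ hk ≫ L.arrow) := by
      rw [Abelian.monoLift_comp]; infer_instance
    exact mono_of_mono _ L.arrow
  have hP := prop_of_prop_kernel_of_prop q (P.prop_of_mono (Abelian.monoLift L.arrow _ hk) hL) hX
  have hle : L ≤ Subobject.mk b :=
    Subobject.le_mk_of_comm (pullback.lift L.arrow 0 (by simp)) (pullback.lift_fst _ _ _)
  have hge : Subobject.mk b ≤ L := by
    by_contra hlt
    exact hmax _ (P.prop_of_iso (Subobject.underlyingIso b).symm hP) (lt_of_le_not_ge hle hlt)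
  apply isZero_of_comp_eq_zero q j
  rw [← hbq, ← Subobject.ofMkLE_arrow hge, Category.assoc, cokernel.condition, comp_zero]

lemma exists_mono_prop_of_mem_ASuppOf {P : ObjectProperty A} [P.IsSerreClass]
    {H : MonoformObject A} (h : (Quotient.mk _ H : ASpec A) ∈ ASuppOf P) :
    ∃ (X : A) (i : X ⟶ H.obj), Mono i ∧ ¬ IsZero X ∧ P X := by
  obtain ⟨N, hN, h⟩ := Set.mem_iUnion₂.1 h
  obtain ⟨Y, i, p, _, hp⟩ := mem_ASupp_iff.1 h
  exact ⟨image p, image.ι p, inferInstance, not_isZero_image hp,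
    P.prop_of_epi (factorThruImage p) (P.prop_of_mono i hN)⟩

/-- If `L` is maximal in `P`, a monoform subobject of `M / L` would have a nonzero subobject in `P`,
which maximality forbids. -/
lemma prop_of_ASupp_subset_of_isNoetherianObject {P : ObjectProperty A} [P.IsSerreClass] {M : A}
    [IsNoetherianObject M] (h : ASupp M ⊆ ASuppOf P) : P M := by
  obtain ⟨L, hL, hmax⟩ := exists_prop_subobject (P := P) M
  by_cases h0 : IsZero (cokernel L.arrow)
  · have : Epi L.arrow := Preadditive.epi_of_cokernel_zero (h0.eq_of_tgt _ _)
    exact P.prop_of_epi L.arrow hL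
  · have : IsNoetherianObject (cokernel L.arrow) := isNoetherianObject_of_epi (cokernel.π L.arrow)
    obtain ⟨H, j, _, hH⟩ := exists_isMonoform_of_isNoetherianObject h0
    obtain ⟨X, i, _, hX, hPX⟩ := exists_mono_prop_of_mem_ASuppOf (P := P) (H := ⟨H, hH⟩)
      (h (ASupp_subset_of_epi (cokernel.π L.arrow)
        (ASupp_subset_of_mono j (mem_ASupp_self ⟨H, hH⟩))))
    exact (hX (hmax (i ≫ j) inferInstance hPX)).elim

/-! ### The order isomorphism given by supports -/

lemma ASuppInv_ASuppOf_of_noetherian [Noetherian.{v, u, w} A] (P : ObjectProperty A)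
    [P.IsSerreClass] : ASuppInv (ASuppOf P) = P := by
  ext M
  exact ⟨fun h => prop_of_ASupp_subset_of_isNoetherianObject h,
    fun h => Set.subset_iUnion₂ (s := fun (M : A) (_ : P M) => ASupp M) M h⟩

/-- The order isomorphism between the members of a class of Serre subcategories and open subsets
of the atom spectrum. -/
def supportOrderIso (C : ObjectProperty A → Prop)
    (hC : ∀ P, C P → ASuppInv (ASuppOf P) = P)
    (hΦ : ∀ Φ : Set (ASpec A), C (ASuppInv Φ)) :
    {P : ObjectProperty A // C P} ≃o TopologicalSpace.Opens (ASpec A) where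
  toFun P := ⟨ASuppOf P.1, isOpen_ASuppOf P.1⟩
  invFun Φ := ⟨ASuppInv Φ, hΦ Φ⟩
  left_inv P := Subtype.ext (hC P.1 P.2)
  right_inv Φ := TopologicalSpace.Opens.ext (ASuppOf_ASuppInv Φ.2)
  map_rel_iff' {P Q} := by
    constructor
    · intro h
      have h' : ASuppOf P.1 ⊆ ASuppOf Q.1 := h
      change P.1 ≤ Q.1
      rw [← hC P.1 P.2, ← hC Q.1 Q.2]
      exact fun M hM => hM.trans h'
    · intro h
      exact Set.iUnion₂_subset fun M hM =>
        Set.subset_iUnion₂ (s := fun (M : A) (_ : Q.1 M) => ASupp M) M (h M hM)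

section Stalks

/-! ### Vanishing in direct limits over nonzero subobjects -/

lemma isDirectedOrder_nonzeroSub (H : MonoformObject A) :
    IsDirectedOrder (NonzeroSub H.obj)ᵒᵈ :=
  ⟨fun L M => ⟨OrderDual.toDual ⟨L.ofDual.1 ⊓ M.ofDual.1,
    H.isMonoform.inf_ne_bot L.ofDual.2 M.ofDual.2⟩,
    (inf_le_left : L.ofDual.1 ⊓ M.ofDual.1 ≤ L.ofDual.1),
    (inf_le_right : L.ofDual.1 ⊓ M.ofDual.1 ≤ M.ofDual.1)⟩⟩

namespace Stalk

variable {H : MonoformObject A} {F F' : Aᵒᵖ ⥤ AddCommGrpCat.{t}}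

lemma exists_of_of_eq_zero {L : NonzeroSub H.obj} {x : F.obj (op (L.1 : A))}
    (h : of (H := H) L x = 0) :
    ∃ (M : NonzeroSub H.obj) (hM : M.1 ≤ L.1), (F.map (Subobject.ofLE _ _ hM).op).hom x = 0 := by
  classical
  have := isDirectedOrder_nonzeroSub H
  have hd : DirectedSystem (sysObj H.obj F) (fun i j h => sysMap H.obj F i j h) :=
    { map_self := fun L x => by
        change (F.map (Subobject.ofLE _ _ _).op).hom x = x
        rw [Subobject.ofLE_refl, op_id, F.map_id]
        rfl
      map_map := fun K M L h h' x => by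
        have e : F.map (Subobject.ofLE M.ofDual.1 L.ofDual.1 h).op ≫
            F.map (Subobject.ofLE K.ofDual.1 M.ofDual.1 h').op =
            F.map (Subobject.ofLE K.ofDual.1 L.ofDual.1 (h.trans h')).op :=
          (F.map_comp _ _).symm.trans (congrArg (fun e => F.map (Quiver.Hom.op e))
            (Subobject.ofLE_comp_ofLE _ _ _ h' h))
        exact ConcreteCategory.congr_hom e x }
  obtain ⟨M, hM, h0⟩ := AddCommGroup.DirectLimit.of.zero_exact (G := sysObj H.obj F)
    (f := sysMap H.obj F) (OrderDual.toDual L) x h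
  exact ⟨M.ofDual, hM, h0⟩

lemma exists_of_ofMono_eq_zero {X : A} {j : X ⟶ H.obj} [Mono j] {hX : ¬ IsZero X}
    {x : F.obj (op X)} (h : ofMono j hX x = 0) :
    ∃ (W : A) (g : W ⟶ X), Mono g ∧ ¬ IsZero W ∧ (F.map g.op).hom x = 0 := by
  obtain ⟨M, hM, h0⟩ := exists_of_of_eq_zero h
  refine ⟨_, Subobject.ofLE _ _ hM ≫ (Subobject.underlyingIso j).hom, inferInstance,
    not_isZero_of_ne_bot M.2, ?_⟩
  rw [op_comp, F.map_comp]
  exact h0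

lemma exists_ofMono (x : Stalk H F) : ∃ (X : A) (j : X ⟶ H.obj) (_ : Mono j) (hX : ¬ IsZero X)
    (y : F.obj (op X)), ofMono j hX y = x := by
  obtain ⟨L, y, rfl⟩ := exists_of x
  exact ⟨_, L.1.arrow, inferInstance, not_isZero_of_ne_bot L.2, y, ofMono_arrow L y⟩

lemma ofMono_eq_of_map {X W : A} (j : X ⟶ H.obj) [Mono j] (hX : ¬ IsZero X)
    (g : W ⟶ X) [Mono g] (hW : ¬ IsZero W) (x : F.obj (op X)) :
    ofMono j hX x = ofMono (g ≫ j) hW ((F.map g.op).hom x) :=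
  (ofMono_comp j hX (g ≫ j) hW g rfl x).symm

end Stalk

/-! ### The residue field is a skew field -/

namespace ResidueField

variable {H : MonoformObject A}

lemma of_arrow (L : NonzeroSub H.obj) : of L L.1.arrow = 1 := by
  refine Eq.trans ?_ (Stalk.of_map (F := preadditiveYoneda.obj H.obj)
    (L := ⟨⊤, top_ne_bot H.isMonoform.not_isZero⟩) (M := L) le_top (⊤ : Subobject H.obj).arrow)
  exact congrArg (of L) (Subobject.ofLE_arrow _).symm

/-- Since `g` lands in `L`, no shrinking of `M` is needed and the product is plain composition. -/
lemma of_mul_of (L : NonzeroSub H.obj) (f : (L.1 : A) ⟶ H.obj) (M : NonzeroSub H.obj)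
    (g : (M.1 : A) ⟶ H.obj) (m : (M.1 : A) ⟶ (L.1 : A)) (hm : g = m ≫ L.1.arrow) :
    of L f * of M g = of M (m ≫ f) := by
  refine (congrArg (fun e => e (of L f)) (act_of (preadditiveYoneda.obj H.obj) M g)).trans ?_
  refine (Stalk.pullEnd_of (F := preadditiveYoneda.obj H.obj) M g L (not_isZero_of_ne_bot M.2)
    M.1.arrow (𝟙 _) (Category.id_comp _) m ((Category.id_comp _).trans hm) f).trans ?_
  exact Stalk.ofMono_arrow (F := preadditiveYoneda.obj H.obj) M (m ≫ f)

instance : Nontrivial (ResidueField H) := by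
  refine ⟨1, 0, fun h => ?_⟩
  obtain ⟨M, hM, h0⟩ := Stalk.exists_of_of_eq_zero (F := preadditiveYoneda.obj H.obj)
    (L := ⟨⊤, top_ne_bot H.isMonoform.not_isZero⟩) (x := (⊤ : Subobject H.obj).arrow) h
  apply not_isZero_of_ne_bot M.2
  apply IsZero.of_mono_eq_zero M.1.arrow
  rw [← Subobject.ofLE_arrow hM]
  exact h0

/-- A nonzero `f : L ⟶ H` is mono because `H` is monoform; the inverse is represented on its image
by the isomorphism back to `L`. -/
lemma isUnit_or_eq_zero (x : ResidueField H) : IsUnit x ∨ x = 0 := by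
  obtain ⟨L, f, rfl⟩ := exists_of x
  by_cases hf : f = 0
  · right
    subst hf
    exact (Stalk.of (F := preadditiveYoneda.obj H.obj) L).map_zero
  · left
    have hm := H.isMonoform.mono_of_ne_zero L.1.arrow f hf
    let M : NonzeroSub H.obj := ⟨Subobject.mk f, mk_ne_bot f (not_isZero_of_ne_bot L.2)⟩
    let e : (M.1 : A) ≅ (L.1 : A) := Subobject.underlyingIso f
    have h₁ : e.hom ≫ f = M.1.arrow := by simp [e, M]
    have h₂ : f = e.inv ≫ M.1.arrow := by rw [← h₁, Iso.inv_hom_id_assoc]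
    refine ⟨⟨of L f, of M (e.hom ≫ L.1.arrow), ?_, ?_⟩, rfl⟩
    · rw [of_mul_of L f M _ e.hom rfl, h₁, of_arrow]
    · rw [of_mul_of M _ L f e.inv h₂, Iso.inv_hom_id_assoc, of_arrow]

instance : DivisionRing (ResidueField H) := DivisionRing.ofIsUnitOrEqZero isUnit_or_eq_zero

/-- Linear forms separate the points of a right vector space over the residue field. -/
lemma exists_linearMap_ne_zero {V : Type*} [AddCommGroup V] [Module (ResidueField H)ᵐᵒᵖ V]
    {x : V} (hx : x ≠ 0) : ∃ φ : V →ₗ[(ResidueField H)ᵐᵒᵖ] ResidueField H, φ x ≠ 0 := by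
  let b := Module.Free.chooseBasis (ResidueField H)ᵐᵒᵖ V
  have h : b.repr x ≠ 0 := by simpa using hx
  obtain ⟨i, hi⟩ := Finsupp.ne_iff.1 h
  -- Coordinates take values in the opposite ring; `u` identifies it with the residue field as a
  -- right module.
  let u : (ResidueField H)ᵐᵒᵖ →ₗ[(ResidueField H)ᵐᵒᵖ] ResidueField H :=
    { toFun := MulOpposite.unop
      map_add' := fun _ _ => rfl
      map_smul' := fun _ _ => rfl }
  refine ⟨u.comp (b.coord i), fun h0 => hi ?_⟩
  exact MulOpposite.unop_injective h0

end ResidueField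

/-! ### Exact sequences of extension groups from an atom -/

lemma Stalk.mapₗ_apply {H : MonoformObject A} {F F' : Aᵒᵖ ⥤ AddCommGrpCat.{t}} [F.Additive]
    [F'.Additive] (φ : F ⟶ F') (x : Stalk H F) : Stalk.mapₗ φ x = Stalk.map φ x := rfl

variable [HasExt.{t} A]

namespace ExtAtomObj

variable {i : ℕ} {α : ASpec A}

/-- The class in `Ext^i(α, N)` of an element of `Ext^i(X, N)`, for `X` a nonzero subobject of the
fixed representative of `α`. -/
def mk {N X : A} (j : X ⟶ α.rep.obj) [Mono j] (hX : ¬ IsZero X) :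
    Abelian.Ext.{t} X N i →+ ExtAtomObj i α N :=
  Stalk.ofMono (F := extTo i N) j hX

lemma exists_mk {N : A} (x : ExtAtomObj i α N) :
    ∃ (X : A) (j : X ⟶ α.rep.obj) (_ : Mono j) (hX : ¬ IsZero X) (y : Abelian.Ext.{t} X N i),
      mk j hX y = x :=
  Stalk.exists_ofMono x

lemma mk_eq_mk_comp {N X W : A} (j : X ⟶ α.rep.obj) [Mono j] (hX : ¬ IsZero X)
    (g : W ⟶ X) [Mono g] (hW : ¬ IsZero W) (y : Abelian.Ext.{t} X N i) :
    mk j hX y = mk (g ≫ j) hW ((Abelian.Ext.mk₀ g).comp y (zero_add i)) :=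
  Stalk.ofMono_eq_of_map (F := extTo i N) j hX g hW y

lemma mk_eq_zero_of_comp {N X W : A} (j : X ⟶ α.rep.obj) [Mono j] (hX : ¬ IsZero X)
    (g : W ⟶ X) [Mono g] (hW : ¬ IsZero W) (y : Abelian.Ext.{t} X N i)
    (h : (Abelian.Ext.mk₀ g).comp y (zero_add i) = 0) : mk j hX y = 0 := by
  rw [mk_eq_mk_comp j hX g hW, h, map_zero]

lemma exists_comp_eq_zero {N X : A} {j : X ⟶ α.rep.obj} [Mono j] {hX : ¬ IsZero X}
    {y : Abelian.Ext.{t} X N i} (h : mk j hX y = 0) : ∃ (W : A) (g : W ⟶ X), Mono g ∧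
      ¬ IsZero W ∧ (Abelian.Ext.mk₀ g).comp y (zero_add i) = 0 :=
  Stalk.exists_of_ofMono_eq_zero (F := extTo i N) h

lemma map_mk {N N' : A} (g : N ⟶ N') {X : A} (j : X ⟶ α.rep.obj) [Mono j] (hX : ¬ IsZero X)
    (y : Abelian.Ext.{t} X N i) :
    ExtAtomObj.map i α g (mk j hX y) = mk j hX (y.comp (Abelian.Ext.mk₀ g) (add_zero i)) := by
  rw [Stalk.mapₗ_apply]
  exact Stalk.map_ofMono ((Abelian.extFunctor i).flip.map g) j hX y

lemma map_id (N : A) (x : ExtAtomObj i α N) : ExtAtomObj.map i α (𝟙 N) x = x := by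
  obtain ⟨X, j, _, hX, y, rfl⟩ := exists_mk x
  rw [map_mk, Abelian.Ext.comp_mk₀_id]

lemma map_comp {N₁ N₂ N₃ : A} (f : N₁ ⟶ N₂) (g : N₂ ⟶ N₃) (x : ExtAtomObj i α N₁) :
    ExtAtomObj.map i α (f ≫ g) x = ExtAtomObj.map i α g (ExtAtomObj.map i α f x) := by
  obtain ⟨X, j, _, hX, y, rfl⟩ := exists_mk x
  rw [map_mk, map_mk, map_mk, Abelian.Ext.comp_assoc_of_second_deg_zero,
    Abelian.Ext.mk₀_comp_mk₀]

/-- Exactness of direct limits: a class that vanishes in the limit already vanishes on a smaller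
`W`, where the long exact sequence applies. -/
lemma exact₂ {N₁ N₂ N₃ : A} {p : N₁ ⟶ N₂} {q : N₂ ⟶ N₃} {w : p ≫ q = 0}
    (hS : (ShortComplex.mk p q w).ShortExact) (x : ExtAtomObj i α N₂)
    (hx : ExtAtomObj.map i α q x = 0) : ∃ y, ExtAtomObj.map i α p y = x := by
  obtain ⟨X, j, _, hX, y, rfl⟩ := exists_mk x
  rw [map_mk] at hx
  obtain ⟨W, g, _, hW, h0⟩ := exists_comp_eq_zero hx
  obtain ⟨z, hz⟩ : ∃ z : Abelian.Ext.{t} W N₁ i, z.comp (Abelian.Ext.mk₀ p) (add_zero i) =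
      (Abelian.Ext.mk₀ g).comp y (zero_add i) := Abelian.Ext.covariant_sequence_exact₂ W hS
    ((Abelian.Ext.mk₀ g).comp y (zero_add i)) (by
      rw [Abelian.Ext.comp_assoc_of_third_deg_zero, h0])
  refine ⟨mk (g ≫ j) hW z, ?_⟩
  rw [map_mk, hz, ← mk_eq_mk_comp]

/-- If `α` is not in the support of `N₃`, the map `Ext¹(α, N₁) → Ext¹(α, N₂)` given by an exact
sequence `0 ⟶ N₁ ⟶ N₂ ⟶ N₃ ⟶ 0` is injective. -/
lemma injective_map_one {N₁ N₂ N₃ : A} {p : N₁ ⟶ N₂} {q : N₂ ⟶ N₃} {w : p ≫ q = 0}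
    (hS : (ShortComplex.mk p q w).ShortExact) (hα : α ∉ ASupp N₃) :
    Function.Injective (ExtAtomObj.map 1 α p) := by
  rw [injective_iff_map_eq_zero]
  intro x hx
  obtain ⟨X, j, _, hX, y, rfl⟩ := exists_mk x
  rw [map_mk] at hx
  obtain ⟨W, g, _, hW, h0⟩ := exists_comp_eq_zero hx
  obtain ⟨z, hz⟩ := Abelian.Ext.covariant_sequence_exact₁ W hS
    ((Abelian.Ext.mk₀ g).comp y (zero_add 1)) (by
      rw [Abelian.Ext.comp_assoc_of_third_deg_zero, h0]) (zero_add 1)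
  obtain ⟨f, rfl⟩ := (Abelian.Ext.mk₀_bijective W N₃).2 z
  -- The restricted class is the boundary of some `f : W ⟶ N₃`. As `α` is not in the support of
  -- `N₃`, `f` is not mono, and on its nonzero kernel the class dies.
  have hK : ¬ IsZero (kernel f) := fun h => hα (by
    have : Mono f := Preadditive.mono_of_kernel_zero (h.eq_of_src _ _)
    exact mem_ASupp_iff_rep.2 ⟨W, f, g ≫ j, this, mono_ne_zero _ hW⟩)
  apply mk_eq_zero_of_comp j hX (kernel.ι f ≫ g) hK
  rw [← Abelian.Ext.mk₀_comp_mk₀_assoc, ← hz, Abelian.Ext.mk₀_comp_mk₀_assoc,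
    kernel.condition, Abelian.Ext.mk₀_zero, Abelian.Ext.zero_comp]

end ExtAtomObj

end Stalks

section EssentialExtensions

variable [HasExt.{t} A]

/-! ### Closure under essential extensions in terms of extension groups -/

/-- Realize a class by `0 ⟶ N ⟶ E ⟶ X ⟶ 0`. As `α` lies in the support of `X`, `E` is not in
`ASuppInv Φ`, so `N` is not essential in `E`: some nonzero `Z ⊆ E` misses `N`. Then `Z` embeds in
`X` and the extension splits over it. -/
lemma subsingleton_extAtomObj_of_closedUnderEssentialExtensions {Φ : Set (ASpec A)}
    (h : ClosedUnderEssentialExtensions (ASuppInv Φ)) {α : ASpec A} (hα : α ∉ Φ) {N : A}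
    (hN : ASuppInv Φ N) : Subsingleton (ExtAtomObj 1 α N) := by
  refine subsingleton_of_forall_eq 0 fun x => ?_
  obtain ⟨X, j, _, hX, y, rfl⟩ := ExtAtomObj.exists_mk x
  obtain ⟨E, i, p, w, hS, rfl⟩ := exists_extClass_eq y
  have : Mono i := hS.mono_f
  have : Epi p := hS.epi_g
  have hess : ¬ IsEssentialMono i := fun hi => hα (by
    have hX' : ASuppInv Φ X := (ASuppInv Φ).prop_of_epi p (h i hi hN)
    exact hX' (mem_ASupp_iff_rep.2 ⟨X, 𝟙 X, j, inferInstance, mono_ne_zero j hX⟩))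
  rw [isEssentialMono_iff_pullback] at hess
  push Not at hess
  obtain ⟨Z, z, _, hz, hZ⟩ := hess
  have : Mono (z ≫ p) := mono_comp_of_isZero_pullback i z hz p fun T x hx =>
    ⟨hS.exact.lift x hx, hS.exact.lift_f x hx⟩
  apply ExtAtomObj.mk_eq_zero_of_comp j hX (z ≫ p) hZ
  rw [← Abelian.Ext.mk₀_comp_mk₀_assoc]
  have h0 : (Abelian.Ext.mk₀ p).comp hS.extClass (zero_add 1) = 0 := hS.comp_extClass
  rw [h0, Abelian.Ext.comp_zero]

/-- Cut a bad essential extension `E` down to a noetherian subobject `U`, and let `L` be maximal in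
`U` supported in `Φ`. Then `L` contains the trace of `M`, and `U / L` has a monoform subobject with
atom outside `Φ`. Vanishing of Ext¹ lifts a nonzero piece of it to `U`, where it misses `L`, against
essentiality. -/
lemma closedUnderEssentialExtensions_of_subsingleton (hA : IsLocallyNoetherian A)
    {Φ : Set (ASpec A)} (hΦ : IsOpen Φ)
    (h : ∀ α ∉ Φ, ∀ N : A, IsNoetherianObject N → ASuppInv Φ N →
      Subsingleton (ExtAtomObj.{t} 1 α N)) :
    ClosedUnderEssentialExtensions (ASuppInv Φ) := by
  intro M E i _ hi hM α hαE
  by_contra hα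
  obtain ⟨X, e, p, _, hp⟩ := mem_ASupp_iff_rep.1 hαE
  obtain ⟨U, u', _, _, hu⟩ := hA.exists_mono p hp
  let u : U ⟶ E := u' ≫ e
  have hαU : α ∈ ASupp U := mem_ASupp_iff_rep.2 ⟨U, 𝟙 U, u' ≫ p, inferInstance, hu⟩
  let k := pullback.snd i u
  have hfst : Mono (pullback.fst i u) := pullback.fst_of_mono
  have hK : ASuppInv Φ (pullback i u) := (ASuppInv Φ).prop_of_mono (pullback.fst i u) hM
  have hk : IsEssentialMono k := hi.pullback_snd u
  obtain ⟨L, hL, hmax⟩ := exists_prop_subobject (P := ASuppInv Φ) U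
  let c := cokernel.π L.arrow
  -- The trace of `M` on `U` is supported in `Φ`, and `U / L` has no nonzero subobject of that kind.
  have hkc : k ≫ c = 0 := by
    have h0 := hmax (image.ι (k ≫ c)) inferInstance
      ((ASuppInv Φ).prop_of_epi (factorThruImage (k ≫ c)) hK)
    rw [← image.fac (k ≫ c), h0.eq_of_src (image.ι (k ≫ c)) 0, comp_zero]
  have hc : ¬ IsZero (cokernel L.arrow) := by
    intro h0
    have : Epi L.arrow := Preadditive.epi_of_cokernel_zero (h0.eq_of_tgt _ _)
    exact hα ((ASuppInv Φ).prop_of_epi L.arrow hL hαU)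
  have : IsNoetherianObject (cokernel L.arrow) := isNoetherianObject_of_epi c
  obtain ⟨H, j, _, hH⟩ := exists_isMonoform_of_isNoetherianObject hc
  let γ : ASpec A := Quotient.mk _ ⟨H, hH⟩
  have hγ : γ ∉ Φ := by
    intro hγ
    obtain ⟨Y, y, _, hY, hYΦ⟩ := exists_mono_ASupp_subset hΦ ⟨H, hH⟩ hγ
    exact hY (hmax (y ≫ j) inferInstance hYΦ)
  have hLn : IsNoetherianObject (L : A) := isNoetherianObject_of_mono L.arrow
  have hsub := h γ hγ (L : A) hLn hL
  obtain ⟨Z, z, z', _, _, hZ⟩ := atom_eq_iff.1 γ.mk_rep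
  have hS : (ShortComplex.mk L.arrow c (cokernel.condition _)).ShortExact :=
    { exact := ShortComplex.exact_of_g_is_cokernel _ (cokernelIsCokernel L.arrow) }
  -- The extension of `U / L` by `L` splits over a nonzero `W`; the splitting is the lift `s` below.
  obtain ⟨W, g, _, hW, h0⟩ := ExtAtomObj.exists_comp_eq_zero (Subsingleton.elim
    (ExtAtomObj.mk z hZ ((Abelian.Ext.mk₀ (z' ≫ j)).comp hS.extClass (zero_add 1))) 0)
  rw [Abelian.Ext.mk₀_comp_mk₀_assoc] at h0
  obtain ⟨s, hs⟩ := Abelian.Ext.covariant_sequence_exact₃ W hS _ _ h0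
  obtain ⟨s, rfl⟩ := (Abelian.Ext.mk₀_bijective W U).2 s
  have hs' : s ≫ c = g ≫ z' ≫ j := by
    rw [Abelian.Ext.mk₀_comp_mk₀] at hs
    exact (Abelian.Ext.mk₀_bijective _ _).1 hs
  have hsc : Mono (s ≫ c) := by rw [hs']; infer_instance
  have hsm : Mono s := mono_of_mono s c
  refine hW ((isEssentialMono_iff_pullback k).1 hk s hsm ?_)
  have : Mono (pullback.snd k s) := pullback.snd_of_mono
  apply IsZero.of_mono_eq_zero (pullback.snd k s)
  rw [← cancel_mono (s ≫ c), ← pullback.condition_assoc, hkc, comp_zero, zero_comp]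

/-! ### Vanishing of limits and virtual duals; eventually constant systems -/

lemma subsingleton_extAtom {Φ : Set (ASpec A)} (hΦ : IsOpen Φ) {i : ℕ} {α β : ASpec A}
    (h : ∀ N : A, ASuppInv Φ N → Subsingleton (ExtAtomObj.{t} i α N)) (hβ : β ∈ Φ) :
    Subsingleton (ExtAtom.{t} i α β) := by
  refine subsingleton_of_forall_eq 0 fun x => Subtype.ext (funext fun L => ?_)
  obtain ⟨M, hM, hMΦ⟩ := exists_nonzeroSub_ASuppInv hΦ hβ L
  have := h _ hMΦ
  rw [← x.2 L M hM, Subsingleton.elim (x.1 M) 0, map_zero]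
  rfl

lemma subsingleton_virtualDualExt {Φ : Set (ASpec A)} (hΦ : IsOpen Φ) {i : ℕ} {α β : ASpec A}
    (h : ∀ N : A, ASuppInv Φ N → Subsingleton (ExtAtomObj.{t} i α N)) (hβ : β ∈ Φ) :
    Subsingleton (VirtualDualExt.{t} i α β) := by
  classical
  have := isDirectedOrder_nonzeroSub β.rep
  have : Nonempty (NonzeroSub β.rep.obj)ᵒᵈ := ⟨OrderDual.toDual ⟨⊤,
    top_ne_bot β.rep.isMonoform.not_isZero⟩⟩
  refine subsingleton_of_forall_eq 0 fun x => ?_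
  obtain ⟨L, φ, rfl⟩ := Module.DirectLimit.exists_of x
  obtain ⟨M, hM, hMΦ⟩ := exists_nonzeroSub_ASuppInv hΦ hβ L.ofDual
  have := h _ hMΦ
  have hM' : L ≤ OrderDual.toDual M := hM
  rw [← Module.DirectLimit.of_f (hij := hM')]
  have h0 : DualExt.map i α (Subobject.ofLE M.1 L.ofDual.1 hM) φ = 0 := by
    apply LinearMap.ext
    intro y
    rw [Subsingleton.elim y 0, map_zero, map_zero]
  exact (congrArg _ h0).trans (map_zero _)

/-- A thread is determined by its values below `L`, and these inject into the value at `L`. -/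
lemma nontrivial_extAtomObj_of_extAtom {i : ℕ} {α β : ASpec A} (L : NonzeroSub β.rep.obj)
    (hL : ∀ (L₁ L₂ : NonzeroSub β.rep.obj) (h : L₂.1 ≤ L₁.1), L₁.1 ≤ L.1 →
      Function.Bijective (ExtAtomObj.map.{t} i α (Subobject.ofLE L₂.1 L₁.1 h)))
    (h : Nontrivial (ExtAtom.{t} i α β)) : ∃ x : ExtAtomObj.{t} i α (L.1 : A), x ≠ 0 := by
  by_contra! h0
  obtain ⟨x, hx⟩ := exists_ne (0 : ExtAtom.{t} i α β)
  refine hx (Subtype.ext (funext fun K => ?_))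
  let M : NonzeroSub β.rep.obj := ⟨K.1 ⊓ L.1, β.rep.isMonoform.inf_ne_bot K.2 L.2⟩
  have hxM : x.1 M = 0 :=
    (hL L M inf_le_right le_rfl).1 ((h0 _).trans (map_zero _).symm)
  rw [← x.2 K M inf_le_left, hxM, map_zero]
  rfl

/-- A nonzero `x` in the stable value at `L` is detected by a linear form `φ`. If `φ` dies in the
direct limit, it dies on some `M ⊆ L`; but `x` comes from `M`, since the transition map is onto. -/
lemma const_inter_eq_empty_of_virtualDualExt {Φ : Set (ASpec A)} {i : ℕ} {α : ASpec A}
    (h : ∀ β ∈ Φ, Subsingleton (VirtualDualExt.{t} i α β)) : Const.{t} i α ∩ Φ = ∅ := by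
  classical
  refine Set.eq_empty_of_forall_notMem ?_
  rintro β ⟨⟨⟨L, hL⟩, hnt⟩, hβ⟩
  obtain ⟨x, hx⟩ := nontrivial_extAtomObj_of_extAtom L hL hnt
  obtain ⟨φ, hφ⟩ := ResidueField.exists_linearMap_ne_zero (H := α.rep) hx
  have := isDirectedOrder_nonzeroSub β.rep
  have := h β hβ
  have hd : DirectedSystem (fun L : (NonzeroSub β.rep.obj)ᵒᵈ => DualExt i α (L.ofDual.1 : A))
      (fun L M h => DualExt.map i α (Subobject.ofLE M.ofDual.1 L.ofDual.1 h)) :=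
    { map_self := fun L φ => by
        apply LinearMap.ext
        intro y
        change φ (ExtAtomObj.map i α (Subobject.ofLE L.ofDual.1 L.ofDual.1 le_rfl) y) = φ y
        rw [Subobject.ofLE_refl, ExtAtomObj.map_id]
      map_map := fun K M L h h' φ => by
        apply LinearMap.ext
        intro y
        change φ (ExtAtomObj.map i α (Subobject.ofLE M.ofDual.1 L.ofDual.1 h)
          (ExtAtomObj.map i α (Subobject.ofLE K.ofDual.1 M.ofDual.1 h') y)) =
          φ (ExtAtomObj.map i α (Subobject.ofLE K.ofDual.1 L.ofDual.1 (h.trans h')) y)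
        rw [← ExtAtomObj.map_comp]
        exact congrArg (fun g => φ (ExtAtomObj.map i α g y)) (Subobject.ofLE_comp_ofLE _ _ _ h' h) }
  obtain ⟨M, hM, h0⟩ := Module.DirectLimit.of.zero_exact (R := ResidueField α.rep)
    (ι := (NonzeroSub β.rep.obj)ᵒᵈ)
    (G := fun L => DualExt i α (L.ofDual.1 : A))
    (f := fun L M h => DualExt.map i α (Subobject.ofLE M.ofDual.1 L.ofDual.1 h))
    (i := OrderDual.toDual L) (x := φ) (Subsingleton.elim (α := VirtualDualExt i α β) _ _)
  obtain ⟨y, rfl⟩ := (hL L M.ofDual hM le_rfl).2 x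
  exact hφ (LinearMap.congr_fun h0 y)

lemma const_inter_eq_empty_of_extAtom {Φ : Set (ASpec A)} {i : ℕ} {α : ASpec A}
    (h : ∀ β ∈ Φ, Subsingleton (ExtAtom.{t} i α β)) : Const.{t} i α ∩ Φ = ∅ := by
  refine Set.eq_empty_of_forall_notMem ?_
  rintro β ⟨⟨_, hnt⟩, hβ⟩
  exact not_subsingleton _ (h β hβ)

/-- The thread through `x` lifts `x` to `K ⊓ L` and pushes it to `K`; injectivity of the stable
transition maps makes the values compatible. -/
lemma nontrivial_extAtom_of_bijective {i : ℕ} {α β : ASpec A} (L : NonzeroSub β.rep.obj)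
    (hL : ∀ (L₁ L₂ : NonzeroSub β.rep.obj) (h : L₂.1 ≤ L₁.1), L₁.1 ≤ L.1 →
      Function.Bijective (ExtAtomObj.map.{t} i α (Subobject.ofLE L₂.1 L₁.1 h)))
    {x : ExtAtomObj.{t} i α (L.1 : A)} (hx : x ≠ 0) : Nontrivial (ExtAtom.{t} i α β) := by
  let inf (K : NonzeroSub β.rep.obj) : NonzeroSub β.rep.obj :=
    ⟨K.1 ⊓ L.1, β.rep.isMonoform.inf_ne_bot K.2 L.2⟩
  have hinf (K) : (inf K).1 ≤ L.1 := inf_le_right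
  have hinf' (K) : (inf K).1 ≤ K.1 := inf_le_left
  choose y hy using fun K => (hL L (inf K) (hinf K) le_rfl).2 x
  let s : ExtAtom.{t} i α β :=
    ⟨fun K => ExtAtomObj.map i α (Subobject.ofLE _ _ (hinf' K)) (y K), fun K M h => by
      have hle : (inf M).1 ≤ (inf K).1 := inf_le_inf_right _ h
      have h1 : ExtAtomObj.map i α (Subobject.ofLE _ _ hle) (y M) = y K := by
        apply (hL L (inf K) (hinf K) le_rfl).1
        rw [← ExtAtomObj.map_comp, Subobject.ofLE_comp_ofLE, hy, hy]
      dsimp only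
      rw [← h1, ← ExtAtomObj.map_comp, ← ExtAtomObj.map_comp, Subobject.ofLE_comp_ofLE,
        Subobject.ofLE_comp_ofLE]⟩
  have hs : s.1 L = x := hy L
  exact ⟨s, 0, fun h0 => hx (by rw [← hs, h0]; rfl)⟩

/-- If `Ext¹(α, N) ≠ 0` for some noetherian object `N` whose support does not contain `α`, then
some atom in the support of `N` belongs to `Const 1 α`. -/
lemma exists_mem_const {α : ASpec A} {N : A} [IsNoetherianObject N] (hα : α ∉ ASupp N)
    (h : Nontrivial (ExtAtomObj.{t} 1 α N)) : ∃ β ∈ Const.{t} 1 α, β ∈ ASupp N := by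
  -- Noetherian induction: a quotient `Q` of `N` with maximal kernel among those with Ext¹(α, Q) ≠
  -- 0, so every proper quotient of `Q` has vanishing Ext¹.
  obtain ⟨_, ⟨Q, q, hq, hQ, rfl⟩, hmax⟩ := (wellFounded_gt (α := Subobject N)).has_min
    {K | ∃ (Q : A) (q : N ⟶ Q), Epi q ∧ Nontrivial (ExtAtomObj.{t} 1 α Q) ∧
      K = kernelSubobject q} ⟨_, N, 𝟙 N, inferInstance, h, rfl⟩
  have hαQ : α ∉ ASupp Q := fun h => hα (ASupp_subset_of_epi q h)
  -- Injectivity uses that `α` is not in the support of `Q / M`; surjectivity uses Ext¹(α, Q / M) =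
  -- 0, by maximality.
  have hbij : ∀ ⦃M : A⦄ (j : M ⟶ Q) [Mono j], ¬ IsZero M →
      Function.Bijective (ExtAtomObj.map.{t} 1 α j) := by
    intro M j _ hM
    have hS : (ShortComplex.mk j (cokernel.π j) (cokernel.condition _)).ShortExact :=
      { exact := ShortComplex.exact_of_g_is_cokernel _ (cokernelIsCokernel j) }
    refine ⟨ExtAtomObj.injective_map_one hS fun h =>
      hαQ (ASupp_subset_of_epi (cokernel.π j) h), fun x => ?_⟩
    have hsub : Subsingleton (ExtAtomObj.{t} 1 α (cokernel j)) := by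
      by_contra hns
      rw [not_subsingleton_iff_nontrivial] at hns
      refine hmax (kernelSubobject (q ≫ cokernel.π j)) ⟨_, q ≫ cokernel.π j, inferInstance, hns,
        rfl⟩ (lt_of_le_not_ge (kernelSubobject_comp_le q _) fun hle => hM ?_)
      apply IsZero.of_mono_eq_zero j
      rw [← cancel_epi (pullback.snd q j), comp_zero, ← pullback.condition]
      have hfac : (kernelSubobject (q ≫ cokernel.π j)).Factors (pullback.fst q j) := by
        apply kernelSubobject_factors
        rw [pullback.condition_assoc, cokernel.condition, comp_zero]
      exact (kernelSubobject_factors_iff _ _).1 (Subobject.factors_of_le _ hle hfac)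
    exact ExtAtomObj.exact₂ hS x (Subsingleton.elim _ _)
  have hQ0 : ¬ IsZero Q := by
    intro h0
    obtain ⟨x, hx⟩ := exists_ne (0 : ExtAtomObj.{t} 1 α Q)
    apply hx
    obtain ⟨X, j, _, hX, y, rfl⟩ := ExtAtomObj.exists_mk x
    have hy : y = 0 := by
      rw [← Abelian.Ext.comp_mk₀_id y, (IsZero.iff_id_eq_zero Q).1 h0, Abelian.Ext.mk₀_zero,
        Abelian.Ext.comp_zero]
    rw [hy, map_zero]
  have hQn : IsNoetherianObject Q := isNoetherianObject_of_epi q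
  obtain ⟨H, j, _, hH⟩ := exists_isMonoform_of_isNoetherianObject hQ0
  let β : ASpec A := Quotient.mk _ ⟨H, hH⟩
  have hβ : β ∈ ASupp N := ASupp_subset_of_epi q (ASupp_subset_of_mono j (mem_ASupp_self ⟨H, hH⟩))
  obtain ⟨Z, z, z', _, _, hZ⟩ := atom_eq_iff.1 β.mk_rep
  let L : NonzeroSub β.rep.obj := ⟨Subobject.mk z, mk_ne_bot z hZ⟩
  let l : (L.1 : A) ⟶ Q := (Subobject.underlyingIso z).hom ≫ z' ≫ j
  have hL : ∀ (L₁ L₂ : NonzeroSub β.rep.obj) (h : L₂.1 ≤ L₁.1), L₁.1 ≤ L.1 →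
      Function.Bijective (ExtAtomObj.map.{t} 1 α (Subobject.ofLE L₂.1 L₁.1 h)) := by
    intro L₁ L₂ h h₁
    -- Both subobjects compare bijectively with `Q`, hence with each other.
    have b₁ := hbij (Subobject.ofLE _ _ h₁ ≫ l) (not_isZero_of_ne_bot L₁.2)
    have b₂ := hbij (Subobject.ofLE _ _ h ≫ Subobject.ofLE _ _ h₁ ≫ l) (not_isZero_of_ne_bot L₂.2)
    have e : ⇑(ExtAtomObj.map.{t} 1 α (Subobject.ofLE _ _ h ≫ Subobject.ofLE _ _ h₁ ≫ l)) =
        ExtAtomObj.map.{t} 1 α (Subobject.ofLE _ _ h₁ ≫ l) ∘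
          ExtAtomObj.map.{t} 1 α (Subobject.ofLE _ _ h) :=
      funext fun x => ExtAtomObj.map_comp _ _ x
    rw [e] at b₂
    exact (Function.Bijective.of_comp_iff' b₁ _).1 b₂
  obtain ⟨x, hx⟩ := exists_ne (0 : ExtAtomObj.{t} 1 α Q)
  obtain ⟨y, hy⟩ := (hbij l (not_isZero_of_ne_bot L.2)).2 x
  have hy0 : y ≠ 0 := by
    rintro rfl
    exact hx (hy.symm.trans (map_zero _))
  exact ⟨β, ⟨⟨L, hL⟩, nontrivial_extAtom_of_bijective L hL hy0⟩, hβ⟩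

/-- The characterizations of the open subsets `Φ` for which `ASuppInv Φ` is closed under essential
extensions. -/
theorem tfae_closedUnderEssentialExtensions (hA : IsLocallyNoetherian A)
    (Φ : TopologicalSpace.Opens (ASpec A)) : List.TFAE [
      ClosedUnderEssentialExtensions (ASuppInv (Φ : Set (ASpec A))),
      ∀ α ∉ Φ, ∀ N : A, ASuppInv (Φ : Set (ASpec A)) N → Subsingleton (ExtAtomObj.{t} 1 α N),
      ∀ α ∉ Φ, ∀ β ∈ Φ, Subsingleton (VirtualDualExt.{t} 1 α β),
      ∀ α ∉ Φ, ∀ β ∈ Φ, Subsingleton (ExtAtom.{t} 1 α β),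
      ∀ α ∉ Φ, Const.{t} 1 α ∩ (Φ : Set (ASpec A)) = ∅] := by
  tfae_have 1 → 2 := fun h α hα N hN =>
    subsingleton_extAtomObj_of_closedUnderEssentialExtensions h hα hN
  tfae_have 2 → 3 := fun h α hα β hβ => subsingleton_virtualDualExt Φ.2 (h α hα) hβ
  tfae_have 2 → 4 := fun h α hα β hβ => subsingleton_extAtom Φ.2 (h α hα) hβ
  tfae_have 3 → 5 := fun h α hα => const_inter_eq_empty_of_virtualDualExt (h α hα)
  tfae_have 4 → 5 := fun h α hα => const_inter_eq_empty_of_extAtom (h α hα)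
  tfae_have 5 → 1 := by
    intro h
    -- Closure needs vanishing only on noetherian `N`, which is what `exists_mem_const` can handle.
    refine closedUnderEssentialExtensions_of_subsingleton.{t} hA Φ.2 fun α hα N _ hN => ?_
    by_contra hns
    rw [not_subsingleton_iff_nontrivial] at hns
    obtain ⟨β, hβ, hβN⟩ := exists_mem_const (fun h' => hα (hN h')) hns
    exact Set.notMem_empty β (h α hα ▸ ⟨hβ, hN hβN⟩)
  tfae_finish

end EssentialExtensions

/-! ### Coproducts in Grothendieck categories -/

/-- Induct on `s`: on the kernel of one `g a` the remaining morphisms are still jointly mono. -/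
lemma prop_of_jointly_mono {P : ObjectProperty A} [P.IsSerreClass] {ι : Type*} {M : ι → A}
    (hM : ∀ j, P (M j)) (s : Finset ι) {X : A} (g : ∀ j, X ⟶ M j)
    (hg : ∀ ⦃T : A⦄ (x : T ⟶ X), (∀ j ∈ s, x ≫ g j = 0) → x = 0) : P X := by
  classical
  induction s using Finset.induction_on generalizing X with
  | empty =>
    apply P.prop_of_isZero
    rw [IsZero.iff_id_eq_zero]
    exact hg _ (by simp)
  | insert a s ha ih =>
    refine prop_of_prop_kernel_of_prop (g a) ?_ (hM a)
    refine ih (fun j => kernel.ι (g a) ≫ g j) fun T x hx => ?_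
    rw [← cancel_mono (kernel.ι (g a)), zero_comp]
    refine hg _ fun j hj => ?_
    rcases Finset.mem_insert.1 hj with rfl | hj
    · simp
    · simpa using hx j hj

lemma prop_finite_coproduct {P : ObjectProperty A} [P.IsSerreClass] {ι : Type*} [Finite ι]
    {M : ι → A} (hM : ∀ j, P (M j)) : P (∐ M) := by
  have := Fintype.ofFinite ι
  have : HasFiniteBiproducts A := HasFiniteBiproducts.of_hasFiniteProducts
  refine prop_of_jointly_mono hM Finset.univ
    (fun j => (biproduct.isoCoproduct M).inv ≫ biproduct.π M j) fun T x hx => ?_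
  rw [← cancel_mono (biproduct.isoCoproduct M).inv, zero_comp]
  apply biproduct.hom_ext
  intro j
  rw [zero_comp, Category.assoc]
  exact hx j (Finset.mem_univ j)

lemma IsEssentialMono.of_comp_left {M E F : A} {i : M ⟶ E} {j : E ⟶ F} [Mono i] [Mono j]
    (h : IsEssentialMono (i ≫ j)) : IsEssentialMono i := by
  rw [isEssentialMono_iff_pullback] at h ⊢
  intro Z z _ hZ
  apply h (z ≫ j) inferInstance
  have hcond : pullback.fst (i ≫ j) (z ≫ j) ≫ i = pullback.snd (i ≫ j) (z ≫ j) ≫ z := by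
    rw [← cancel_mono j]
    simpa using pullback.condition (f := i ≫ j) (g := z ≫ j)
  have : Mono (pullback.snd (i ≫ j) (z ≫ j)) := pullback.snd_of_mono
  apply IsZero.of_mono_eq_zero (pullback.snd (i ≫ j) (z ≫ j))
  rw [← pullback.lift_snd (f := i) (g := z) _ _ hcond, hZ.eq_of_src (pullback.snd i z) 0, comp_zero]

section Grothendieck

variable [IsGrothendieckAbelian.{w} A]

/-- A morphism from a subobject of a filtered colimit vanishes if it vanishes on the inverse
images of the terms. -/
lemma eq_zero_of_pullback_snd_comp {J : Type w} [SmallCategory J] [IsFiltered J] {F : J ⥤ A}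
    {c : Cocone F} (hc : IsColimit c) {X Y : A} (f : X ⟶ c.pt) [Mono f] (p : X ⟶ Y)
    (h : ∀ j, pullback.snd (c.ι.app j) f ≫ p = 0) : p = 0 := by
  have := IsFiltered.isConnected J
  -- Pushing out along the mono `f` replaces `p` by the restriction of a morphism defined on the
  -- whole colimit, without losing information since `pushout.inr` is mono.
  have h0 : f ≫ pushout.inl f p = 0 := hc.pullback_zero_ext fun j => by
    rw [pushout.condition, reassoc_of% (h j), zero_comp]
  rw [← cancel_mono (pushout.inr f p), ← pushout.condition, h0, zero_comp]

-- A coproduct is the filtered colimit of its finite subcoproducts, so a nonzero morphism from a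
-- subobject `X` stays nonzero on the trace of `X` on one of them; finite coproducts lie in the
-- Serre subcategory.
open CoproductsFromFiniteFiltered in
lemma ASuppInv_coproduct (Φ : Set (ASpec A)) {ι : Type w} {M : ι → A}
    (hM : ∀ j, ASuppInv Φ (M j)) : ASuppInv Φ (∐ M) := by
  intro α hα
  obtain ⟨X, i', p, hi, hp⟩ := mem_ASupp_iff_rep.1 hα
  let i : X ⟶ (finiteSubcoproductsCocone M).pt := i'
  have : Mono i := hi
  have hc := isColimitFiniteSubproductsCocone M
  have h : ∃ S, pullback.snd ((finiteSubcoproductsCocone M).ι.app S) i ≫ p ≠ 0 := by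
    by_contra! h
    exact hp (eq_zero_of_pullback_snd_comp hc i p h)
  obtain ⟨S, hS⟩ := h
  have hfin : ASuppInv Φ ((liftToFinsetObj (Discrete.functor M)).obj S) :=
    prop_finite_coproduct (M := fun x : S => (Discrete.functor M).obj x) fun j => hM j.1.as
  have : Mono (pullback.fst ((finiteSubcoproductsCocone M).ι.app S) i) := pullback.fst_of_mono
  exact hfin (mem_ASupp_iff_rep.2 ⟨_, pullback.fst ((finiteSubcoproductsCocone M).ι.app S) i,
    _, this, hS⟩)

lemma isClosedUnderColimitsOfShape_ASuppInv (Φ : Set (ASpec A)) (J : Type w) :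
    (ASuppInv Φ).IsClosedUnderColimitsOfShape (Discrete J) := by
  refine ObjectProperty.IsClosedUnderColimitsOfShape.mk' ?_
  rintro _ ⟨F, hF⟩
  exact (ASuppInv Φ).prop_of_iso (Sigma.isoColimit F)
    (ASuppInv_coproduct Φ fun j => hF ⟨j⟩)

/-- Every `M` is a quotient of the coproduct of its noetherian subobjects, each of which lies in `P`
by the noetherian case. -/
lemma ASuppInv_ASuppOf_of_isLocallyNoetherian (hA : IsLocallyNoetherian A) (P : ObjectProperty A)
    [P.IsSerreClass] (hP : ∀ J : Type w, P.IsClosedUnderColimitsOfShape (Discrete J)) :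
    ASuppInv (ASuppOf P) = P := by
  ext M
  refine ⟨fun h => ?_,
    fun h => Set.subset_iUnion₂ (s := fun (M : A) (_ : P M) => ASupp M) M h⟩
  let T := {L : Subobject M // IsNoetherianObject (L : A)}
  let e := equivShrink.{w} T
  let D (j : Shrink.{w} T) : A := ((e.symm j).1 : A)
  let d : ∐ D ⟶ M := Sigma.desc fun j => (e.symm j).1.arrow
  have hD : P (∐ D) := P.prop_colimit _ fun j => by
    have : IsNoetherianObject (D j.as) := (e.symm j.as).2
    change P (D j.as)
    exact prop_of_ASupp_subset_of_isNoetherianObject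
      ((ASupp_subset_of_mono (e.symm j.as).1.arrow).trans h)
  have hd : Epi d := by
    apply Preadditive.epi_of_cokernel_zero
    by_contra h0
    obtain ⟨U, g, _, hU, hg⟩ := hA.exists_mono (cokernel.π d) h0
    apply hg
    have hU' : IsNoetherianObject (Subobject.mk g : A) :=
      isNoetherianObject_of_mono (Subobject.underlyingIso g).hom
    let j : Shrink.{w} T := e ⟨Subobject.mk g, hU'⟩
    have hj : e.symm j = ⟨Subobject.mk g, hU'⟩ := e.symm_apply_apply _
    have hz : (e.symm j).1.arrow ≫ cokernel.π d = 0 := by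
      have hdj : Sigma.ι D j ≫ d = (e.symm j).1.arrow := Sigma.ι_desc _ _
      rw [← hdj, Category.assoc, cokernel.condition, comp_zero]
    rw [hj] at hz
    rw [← Subobject.underlyingIso_arrow g, Category.assoc, hz, comp_zero]
  exact P.prop_of_epi d hD

/-! ### Injective envelopes -/

lemma comp_arrow_eq_zero_of_inf_eq_bot {X T : A} {L B : Subobject X} (h : L ⊓ B = ⊥)
    (x : T ⟶ (L : A)) (y : T ⟶ (B : A)) (hxy : x ≫ L.arrow = y ≫ B.arrow) :
    x ≫ L.arrow = 0 := by
  rw [← Subobject.bot_factors_iff_zero, ← h, Subobject.inf_factors]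
  refine ⟨Subobject.factors_comp_arrow _, ?_⟩
  rw [hxy]
  exact Subobject.factors_comp_arrow _

/-- The union of a directed family of subobjects that meet `B` trivially meets `B` trivially. -/
lemma exists_upperBound_inf_eq_bot {X : A} {B : Subobject X} {J : Type w} [Preorder J]
    [IsDirectedOrder J] [Nonempty J] {φ : J → Subobject X} (hφ : Monotone φ)
    (hB : ∀ j, φ j ⊓ B = ⊥) : ∃ K : Subobject X, K ⊓ B = ⊥ ∧ ∀ j, φ j ≤ K := by
  let F : J ⥤ MonoOver X :=
    { obj := fun j => Subobject.representative.obj (φ j)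
      map := fun h => Subobject.representative.map (homOfLE (hφ (leOfHom h)))
      map_id := fun _ => Subsingleton.elim _ _
      map_comp := fun _ _ => Subsingleton.elim _ _ }
  let G : J ⥤ A := F ⋙ MonoOver.forget _ ⋙ Over.forget _
  let f : colimit G ⟶ X := colimit.desc G
    { pt := X
      ι :=
        { app := fun j => (φ j).arrow
          naturality := fun a b h =>
            (Subobject.underlying_arrow (homOfLE (hφ (leOfHom h)))).trans
              (Category.comp_id _).symm } }
  have hf (j : J) : colimit.ι G j ≫ f = (φ j).arrow := colimit.ι_desc _ _
  have hm : Mono f := IsGrothendieckAbelian.mono_of_isColimit_monoOver F (colimit.isColimit G) f hf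
  refine ⟨Subobject.mk f, ?_, fun j => Subobject.le_mk_of_comm (colimit.ι G j) (hf j)⟩
  suffices h : IsZero (pullback f B.arrow) by
    rwa [isZero_pullback_iff, Subobject.mk_arrow] at h
  rw [IsZero.iff_id_eq_zero]
  have : Mono (pullback.fst f B.arrow) := pullback.fst_of_mono
  -- The identity of the intersection of the union with `B` is tested on its intersection with each
  -- `φ j`.
  refine eq_zero_of_pullback_snd_comp (colimit.isColimit G) (pullback.fst f B.arrow) _ fun j => ?_
  have hcond : pullback.fst (colimit.ι G j) (pullback.fst f B.arrow) ≫ (φ j).arrow =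
      (pullback.snd (colimit.ι G j) (pullback.fst f B.arrow) ≫ pullback.snd f B.arrow) ≫
        B.arrow := by
    rw [← hf, pullback.condition_assoc, Category.assoc, pullback.condition]
  have h0 := hcond.symm.trans (comp_arrow_eq_zero_of_inf_eq_bot (hB j) _ _ hcond)
  have hmono : Mono (pullback.snd f B.arrow) := pullback.snd_of_mono
  rw [← cancel_mono (pullback.snd f B.arrow ≫ B.arrow), zero_comp, Category.comp_id,
    ← Category.assoc]
  exact h0

lemma exists_maximal_inf_eq_bot {X : A} {L B : Subobject X} (h : L ⊓ B = ⊥) :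
    ∃ K : Subobject X, L ≤ K ∧ K ⊓ B = ⊥ ∧ ∀ K', K ≤ K' → K' ⊓ B = ⊥ → K' ≤ K := by
  have hchain : ∀ c ⊆ {K : Subobject X | K ⊓ B = ⊥}, IsChain (· ≤ ·) c → ∀ y ∈ c,
      ∃ K ∈ {K : Subobject X | K ⊓ B = ⊥}, ∀ L ∈ c, L ≤ K := by
    intro c hcs hc y hy
    -- `A` is well-powered, so the chain can be indexed by a type in the universe where filtered
    -- colimits are exact.
    let e := equivShrink.{w} c
    let φ (j : Shrink.{w} c) : Subobject X := (e.symm j).1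
    let _ : Preorder (Shrink.{w} c) := Preorder.lift φ
    have : Nonempty (Shrink.{w} c) := ⟨e ⟨y, hy⟩⟩
    have : IsDirectedOrder (Shrink.{w} c) := ⟨fun a b => by
      rcases hc.total (e.symm a).2 (e.symm b).2 with h | h
      · exact ⟨b, h, le_rfl⟩
      · exact ⟨a, le_rfl, h⟩⟩
    obtain ⟨K, hK, hle⟩ := exists_upperBound_inf_eq_bot (φ := φ) (fun _ _ h => h)
      fun j => hcs (e.symm j).2
    refine ⟨K, hK, fun L hL => ?_⟩
    simpa [φ] using hle (e ⟨L, hL⟩)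
  obtain ⟨K, hLK, hK⟩ := zorn_le_nonempty₀ _ hchain L h
  exact ⟨K, hLK, hK.1, fun K' h1 h2 => hK.2 h2 h1⟩

/-- Every object of a Grothendieck category has an injective envelope. -/
theorem exists_injective_envelope (M : A) :
    ∃ (E : A) (i : M ⟶ E) (_ : Mono i), Injective E ∧ IsEssentialMono i := by
  let I := Injective.under M
  let m : M ⟶ I := Injective.ι M
  let B : Subobject I := Subobject.mk m
  -- `K` is a maximal complement of `M` in the injective `I`, and `E` a maximal complement of `K`
  -- containing `M`; the goal is that `E` is a retract of `I`.
  obtain ⟨K, -, hKB, hK⟩ := exists_maximal_inf_eq_bot (L := ⊥) (B := B) (bot_inf_eq _)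
  obtain ⟨E, hBE, hEK, hE⟩ := exists_maximal_inf_eq_bot (L := B) (B := K) (by rwa [inf_comm])
  let q := cokernel.π K.arrow
  let ε := E.arrow ≫ q
  have hε : Mono ε := by
    apply Preadditive.mono_of_cancel_zero
    intro T x hx
    have hx' : (x ≫ E.arrow) ≫ q = 0 := by simpa [ε] using hx
    have := comp_arrow_eq_zero_of_inf_eq_bot hEK x (Abelian.monoLift K.arrow _ hx') (by simp)
    rwa [← cancel_mono E.arrow, zero_comp]
  let b : M ⟶ (E : A) := Subobject.ofMkLE m E hBE
  have hb : b ≫ E.arrow = m := Subobject.ofMkLE_arrow hBE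
  have hbm : Mono b := inferInstance
  -- A subobject of `I / K` that misses `M` has a preimage in `I` missing `M`, which is contained in
  -- `K` by maximality.
  have hess : IsEssentialMono (b ≫ ε) := by
    rw [isEssentialMono_iff_pullback]
    intro Z z _ hZ
    have : Mono (pullback.fst q z) := pullback.fst_of_mono
    have hKY : K ≤ Subobject.mk (pullback.fst q z) :=
      Subobject.le_mk_of_comm (pullback.lift K.arrow 0 (by simp [q])) (pullback.lift_fst _ _ _)
    have hYB : Subobject.mk (pullback.fst q z) ⊓ B = ⊥ := by
      rw [← isZero_pullback_iff]
      have hs : Mono (pullback.snd (pullback.fst q z) m) := pullback.snd_of_mono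
      apply IsZero.of_mono_eq_zero (pullback.snd (pullback.fst q z) m)
      have hcond : pullback.snd (pullback.fst q z) m ≫ b ≫ ε =
          (pullback.fst (pullback.fst q z) m ≫ pullback.snd q z) ≫ z := by
        simp only [ε]
        rw [reassoc_of% hb, ← pullback.condition_assoc, pullback.condition, Category.assoc]
      rw [← pullback.lift_fst (f := b ≫ ε) (g := z) _ _ hcond,
        hZ.eq_of_src (pullback.fst (b ≫ ε) z) 0, comp_zero]
    have hYK := hK _ hKY hYB
    have : Epi (pullback.snd q z) := Abelian.epi_pullback_of_epi_f _ _
    apply isZero_of_comp_eq_zero (pullback.snd q z) z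
    rw [← pullback.condition, ← Subobject.ofMkLE_arrow hYK, Category.assoc, cokernel.condition,
      comp_zero]
  have hεess : IsEssentialMono ε := hess.of_comp
  -- Injectivity of `I` extends the inclusion of `E` to `I / K`. By essentiality `g` is mono with
  -- image missing `K`, so maximality of `E` puts the image inside `E`, giving the retraction.
  let g : cokernel K.arrow ⟶ I := Injective.factorThru E.arrow ε
  have hg : ε ≫ g = E.arrow := Injective.comp_factorThru _ _
  have hgm : Mono g := by
    have : Mono (ε ≫ g) := by rw [hg]; infer_instance
    exact hεess.mono_of_mono g
  have hgK : Subobject.mk g ⊓ K = ⊥ := by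
    suffices h : IsZero (pullback g K.arrow) by
      rwa [isZero_pullback_iff, Subobject.mk_arrow] at h
    have hf : Mono (pullback.fst g K.arrow) := pullback.fst_of_mono
    apply (isEssentialMono_iff_pullback ε).1 hεess (pullback.fst g K.arrow) hf
    have hf' : Mono (pullback.fst ε (pullback.fst g K.arrow)) := pullback.fst_of_mono
    apply IsZero.of_mono_eq_zero (pullback.fst ε (pullback.fst g K.arrow) ≫ E.arrow)
    refine comp_arrow_eq_zero_of_inf_eq_bot hEK _
      (pullback.snd ε (pullback.fst g K.arrow) ≫ pullback.snd g K.arrow) ?_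
    have hcond : pullback.fst ε (pullback.fst g K.arrow) ≫ ε ≫ g =
        (pullback.snd ε (pullback.fst g K.arrow) ≫ pullback.snd g K.arrow) ≫ K.arrow := by
      rw [pullback.condition_assoc, pullback.condition, Category.assoc]
    rwa [hg] at hcond
  have hgE : Subobject.mk g ≤ E := hE _ (Subobject.le_mk_of_comm ε hg) hgK
  let r : cokernel K.arrow ⟶ (E : A) := Subobject.ofMkLE g E hgE
  have hr : ε ≫ r = 𝟙 _ := by
    rw [← cancel_mono E.arrow, Category.assoc, Subobject.ofMkLE_arrow, hg, Category.id_comp]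
  have hinj : Injective (E : A) := Retract.injective (Y := I)
    { i := E.arrow
      r := q ≫ r
      retract := by rw [← Category.assoc]; exact hr }
  exact ⟨(E : A), b, hbm, hinj, hess.of_comp_left⟩

/-- An injective envelope of an essential extension `E` of `M` is also one of `M`, and it contains
`E`. -/
lemma closedUnderInjectiveEnvelopes_iff (P : ObjectProperty A) [P.IsSerreClass] :
    ClosedUnderInjectiveEnvelopes P ↔ ClosedUnderEssentialExtensions P := by
  constructor
  · intro h M E i _ hi hM
    obtain ⟨F, j, _, hF, hj⟩ := exists_injective_envelope E
    exact P.prop_of_mono j (h (i ≫ j) hF (hi.comp hj) hM)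
  · intro h M E i _ _ hi hM
    exact h i hi hM

end Grothendieck

/-! ### Assembly of the theorem -/

/-- An order isomorphism restricts to subtypes that correspond to each other. -/
lemma exists_orderIso_subtype {X Y : Type*} [LE X] [LE Y] (e : X ≃o Y) {p : X → Prop}
    {q : Y → Prop} (h : ∀ y, p (e.symm y) ↔ q y) :
    ∃ e' : {x // p x} ≃o {y // q y}, ∀ x, (e' x).1 = e x.1 := by
  have h' : ∀ x, p x ↔ q (e x) := fun x => by rw [← h, e.symm_apply_apply]
  exact ⟨{ e.toEquiv.subtypeEquiv h' with map_rel_iff' := e.map_rel_iff }, fun _ => rfl⟩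

end AtomExt

end

open CategoryTheory TopologicalSpace AtomExt in
theorem theorem6 :
    -- locally noetherian Grothendieck categories
    (∀ (G : Type u) [Category.{v} G] [Abelian G] [IsGrothendieckAbelian.{w} G] [HasExt.{t} G],
      HasNoetherianGenerators.{w} G →
      (∃ e : LocalizingSubcategory.{w} G ≃o Opens (ASpec G),
        (∀ X, (e X : Set (ASpec G)) = ASuppOf X.1) ∧
        (∀ Φ : Opens (ASpec G), (e.symm Φ).1 = ASuppInv (Φ : Set (ASpec G))) ∧
        ∃ e' : {X : LocalizingSubcategory.{w} G // ClosedUnderInjectiveEnvelopes X.1} ≃o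
            {Φ : Opens (ASpec G) // ∀ α ∉ Φ, ∀ β ∈ Φ, Subsingleton (ExtAtom 1 α β)},
          ∀ X, (e' X).1 = e X.1) ∧
      ∀ Φ : Opens (ASpec G), List.TFAE [
        ClosedUnderEssentialExtensions (ASuppInv (Φ : Set (ASpec G))),
        ∀ α ∉ Φ, ∀ N : G, ASuppInv (Φ : Set (ASpec G)) N → Subsingleton (ExtAtomObj 1 α N),
        ∀ α ∉ Φ, ∀ β ∈ Φ, Subsingleton (VirtualDualExt 1 α β),
        ∀ α ∉ Φ, ∀ β ∈ Φ, Subsingleton (ExtAtom 1 α β),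
        ∀ α ∉ Φ, Const 1 α ∩ (Φ : Set (ASpec G)) = ∅]) ∧
    -- noetherian abelian categories
    (∀ (A : Type u) [Category.{v} A] [Abelian A] [Noetherian.{v, u, w} A] [HasExt.{t} A],
      (∃ e : SerreSubcategory A ≃o Opens (ASpec A),
        (∀ S, (e S : Set (ASpec A)) = ASuppOf S.1) ∧
        (∀ Φ : Opens (ASpec A), (e.symm Φ).1 = ASuppInv (Φ : Set (ASpec A))) ∧
        ∃ e' : {S : SerreSubcategory A // ClosedUnderEssentialExtensions S.1} ≃o
            {Φ : Opens (ASpec A) // ∀ α ∉ Φ, ∀ β ∈ Φ, Subsingleton (ExtAtom 1 α β)},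
          ∀ S, (e' S).1 = e S.1) ∧
      ∀ Φ : Opens (ASpec A), List.TFAE [
        ClosedUnderEssentialExtensions (ASuppInv (Φ : Set (ASpec A))),
        ∀ α ∉ Φ, ∀ N : A, ASuppInv (Φ : Set (ASpec A)) N → Subsingleton (ExtAtomObj 1 α N),
        ∀ α ∉ Φ, ∀ β ∈ Φ, Subsingleton (VirtualDualExt 1 α β),
        ∀ α ∉ Φ, ∀ β ∈ Φ, Subsingleton (ExtAtom 1 α β),
        ∀ α ∉ Φ, Const 1 α ∩ (Φ : Set (ASpec A)) = ∅]) := by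
  refine ⟨fun G _ _ _ _ hG => ?_, fun A _ _ _ _ => ?_⟩
  · have hG' := hG.isLocallyNoetherian
    have htfae := tfae_closedUnderEssentialExtensions.{t} hG'
    let e : LocalizingSubcategory.{w} G ≃o Opens (ASpec G) := supportOrderIso _
      (fun P hP => by
        have := hP.1
        exact ASuppInv_ASuppOf_of_isLocallyNoetherian hG' P hP.2)
      (fun Φ => ⟨inferInstance, isClosedUnderColimitsOfShape_ASuppInv Φ⟩)
    refine ⟨⟨e, fun _ => rfl, fun _ => rfl, exists_orderIso_subtype e fun Φ => ?_⟩, htfae⟩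
    have : ((e.symm Φ).1).IsSerreClass := (e.symm Φ).2.1
    -- The indices of `out` count from zero: 0 is closure under essential extensions, 3 the
    -- vanishing of Ext¹(α, β).
    exact (closedUnderInjectiveEnvelopes_iff.{w} (e.symm Φ).1).trans ((htfae Φ).out 0 3)
  · have htfae := tfae_closedUnderEssentialExtensions.{t}
      (isLocallyNoetherian_of_noetherian.{w} (A := A))
    let e : SerreSubcategory A ≃o Opens (ASpec A) := supportOrderIso _
      (fun P hP => ASuppInv_ASuppOf_of_noetherian.{w} P) (fun Φ => inferInstance)
    exact ⟨⟨e, fun _ => rfl, fun _ => rfl,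
      exists_orderIso_subtype e fun Φ => (htfae Φ).out 0 3⟩, htfae⟩
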